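/- For an integer $k$ let $S_k$ be the complex vector space of cusp forms of weight $k$ for $SL_2(\mathbb{Z})$, with Hecke operators $T_m$, $m\ge 1$. An \emph{eigenform} is a nonzero $f\in S_k$ that is an eigenvector of every $T_m$ (it need not be normalised). Maeda's conjecture for $S_k\neq 0$ says that the Hecke algebra of $S_k$ over $\mathbb{Q}$, i.e. the $\mathbb{Q}$-algebra of endomorphisms of $S_k$ generated by all $T_m$, is a single number field whose Galois closure over $\mathbb{Q}$ has Galois group isomorphic to the symmetric group on $\dim S_k$ letters. \textbf{Theorem.} Assume Maeda's conjecture for all $S_k\ne 0$. (1) Let $f\in S_k$ be an eigenform, let $g_1,\dots,g_d\in S_{2k}$ be pairwise non-proportional eigenforms, and let $c_1,\dots,c_d\in\mathbb{C}$ be nonzero with $f^2=\sum_{i=1}^d c_ig_i$. Then $d=\dim S_{2k}$, and every eigenform in $S_{2k}$ is a scalar multiple of one of the $g_i$; that is, the identity is forced by dimension considerations. (2) In particular, up to rescaling the eigenforms and exchanging $g_1$ and $g_2$, there are exactly two identities $f^2=a_1g_1+a_2g_2$ with $a_1,a_2\in\mathbb{C}$ and eigenforms $f\in S_k$, $g_1,g_2\in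 S_{2k}$, one with $k=12$ and one with $k=16$. Writing $\Delta=q\prod_{n\ge1}(1-q^n)^{24}$, and $E_4,E_6,E_{12}$ for the Eisenstein series for $SL_2(\mathbb{Z})$ with constant term $1$, they are as follows. - $k=12$: $f=\Delta$, $g_1=G(\sqrt{144169})$, $g_2=G(-\sqrt{144169})$, where $G(r)=E_{12}\Delta+\left(12r+\tfrac{324204}{691}\right)\Delta^2$, and $a_1=-a_2=\frac{1}{24\sqrt{144169}}$. - $k=16$: $f=E_4\Delta$, $g_1=H(\sqrt{18295489})$, $g_2=H(-\sqrt{18295489})$, where $H(r)=\Delta\left(xE_4^5+(1-x)E_4^2E_6^2\right)$ with $x=\frac{12r+20532}{1728}$, and $a_1=-a_2=\frac{1}{24\sqrt{18295489}}$. -/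

import Mathlib

open scoped MatrixGroups ModularForm Manifold

noncomputable section

namespace HeckeSquare

/-! ### Hecke operators in level one -/

/-- An integral `2 × 2` matrix of determinant `m ≥ 1`, seen in `GL₂(ℝ)`. -/
def toGL {m : ℕ+} (A : FixedDetMatrix (Fin 2) ℤ (m : ℤ)) : GL (Fin 2) ℝ :=
  Matrix.GeneralLinearGroup.mkOfDetNeZero (A.1.map (Int.cast : ℤ → ℝ)) (by
    have h : (A.1.map (Int.cast : ℤ → ℝ)).det = ((A.1.det : ℤ) : ℝ) :=
      (Int.cast_det A.1).symm
    rw [h, A.2]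
    exact_mod_cast m.pos.ne')

/-- The image under `T_m` of a function on the upper half-plane: the sum of `f ∣[k] A` over the
matrices `A = (a b; 0 d)` with `a, d > 0`, `ad = m` and `0 ≤ b < d` (these form the finite set
`FixedDetMatrices.reps m`). The weight `k` slash action of Mathlib,
`(f ∣[k] A)(z) = (det A)^(k-1) (cz+d)^(-k) f(Az)`, contains the usual normalising power of `m`,
so that on `q`-expansions `a_n(T_m f) = ∑_{e ∣ (m, n)} e^(k-1) a_{mn/e²}(f)`. -/
def heckeFun (k : ℤ) (m : ℕ+) (f : UpperHalfPlane → ℂ) : UpperHalfPlane → ℂ :=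
  ∑ A : FixedDetMatrices.reps (m : ℤ), f ∣[k] (toGL A.1)

/-- Right multiplication of a matrix of determinant `m` by an element of `SL₂(ℤ)`. -/
def mulRight {m : ℕ+} (A : FixedDetMatrix (Fin 2) ℤ (m : ℤ)) (γ : SL(2, ℤ)) :
    FixedDetMatrix (Fin 2) ℤ (m : ℤ) :=
  ⟨A.1 * γ.1, by rw [Matrix.det_mul, A.2, γ.2, mul_one]⟩

theorem toGL_smul {m : ℕ+} (γ : SL(2, ℤ)) (A : FixedDetMatrix (Fin 2) ℤ (m : ℤ)) :
    toGL (γ • A) = (Matrix.SpecialLinearGroup.mapGL ℝ γ) * toGL A := by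
  ext i j
  simp [toGL, FixedDetMatrices.smul_coe, Matrix.mul_apply]

theorem toGL_mulRight {m : ℕ+} (γ : SL(2, ℤ)) (A : FixedDetMatrix (Fin 2) ℤ (m : ℤ)) :
    toGL (mulRight A γ) = toGL A * (Matrix.SpecialLinearGroup.mapGL ℝ γ) := by
  ext i j
  simp [toGL, mulRight, Matrix.mul_apply]

theorem exists_reduce_eq_smul {m : ℤ} (A : FixedDetMatrix (Fin 2) ℤ m) :
    ∃ γ : SL(2, ℤ), FixedDetMatrices.reduce A = γ • A := by
  induction A using FixedDetMatrices.reduce_rec with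
  | base A h =>
    by_cases h1 : 0 < A.1 0 0
    · exact ⟨_, FixedDetMatrices.reduce_of_pos h h1⟩
    · exact ⟨_, (FixedDetMatrices.reduce_of_not_pos h h1).trans (by rw [← mul_smul, ← mul_smul])⟩
  | step A h ih =>
    obtain ⟨γ, hγ⟩ := ih
    rw [FixedDetMatrices.reduce_reduceStep h] at hγ
    exact ⟨_, hγ.trans (by rw [FixedDetMatrices.reduceStep, ← mul_smul, ← mul_smul])⟩

theorem reps_unique {m : ℕ+} {A B : FixedDetMatrix (Fin 2) ℤ (m : ℤ)}
    (hA : A ∈ FixedDetMatrices.reps (m : ℤ)) (hB : B ∈ FixedDetMatrices.reps (m : ℤ))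
    (γ : SL(2, ℤ)) (h : A = γ • B) : A = B := by
  obtain ⟨a10, a00, a01, a11⟩ := hA
  obtain ⟨b10, b00, b01, b11⟩ := hB
  have hd := γ.2
  rw [Matrix.det_fin_two] at hd
  have e : ∀ i j, A.1 i j = γ.1 i 0 * B.1 0 j + γ.1 i 1 * B.1 1 j := fun i j ↦ by
    rw [h, FixedDetMatrices.smul_coe, Matrix.mul_apply, Fin.sum_univ_two]
  have e00 := e 0 0
  have e01 := e 0 1
  have e10 := e 1 0
  have e11 := e 1 1
  rw [b10, mul_zero, add_zero] at e00 e10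
  have g10 : γ.1 1 0 = 0 := by
    rw [a10] at e10
    rcases mul_eq_zero.mp e10.symm with h | h
    · exact h
    · exact absurd h b00.ne'
  rw [g10, mul_zero, sub_zero] at hd
  rw [g10, zero_mul, zero_add] at e11
  have g00 : 0 < γ.1 0 0 := by
    rw [e00] at a00
    nlinarith
  have g00' : γ.1 0 0 = 1 := Int.eq_one_of_mul_eq_one_right g00.le hd
  rw [g00', one_mul] at hd
  rw [hd, one_mul] at e11
  rw [g00', one_mul] at e00 e01
  have g01 : γ.1 0 1 = 0 := by
    by_contra hne
    rw [e11] at a11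
    rw [abs_of_nonneg b01] at b11
    rw [abs_of_nonneg a01] at a11
    have h1 : |A.1 0 1 - B.1 0 1| < |B.1 1 1| := by rw [abs_lt]; constructor <;> linarith
    have h2 : A.1 0 1 - B.1 0 1 = γ.1 0 1 * B.1 1 1 := by rw [e01]; ring
    rw [h2, abs_mul] at h1
    have h3 : 1 ≤ |γ.1 0 1| := Int.one_le_abs hne
    nlinarith [abs_nonneg (B.1 1 1)]
  rw [g01, zero_mul, add_zero] at e01
  ext i j
  fin_cases i <;> fin_cases j
  · exact e00
  · exact e01
  · exact a10.trans b10.symm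
  · exact e11

/-- The permutation of `SL₂(ℤ)`-orbit representatives induced by right multiplication. -/
def repsMap (m : ℕ+) (γ : SL(2, ℤ)) (A : FixedDetMatrices.reps (m : ℤ)) :
    FixedDetMatrices.reps (m : ℤ) :=
  ⟨FixedDetMatrices.reduce (mulRight A.1 γ),
    FixedDetMatrices.reduce_mem_reps (by exact_mod_cast m.pos.ne') _⟩

theorem repsMap_bijective (m : ℕ+) (γ : SL(2, ℤ)) : Function.Bijective (repsMap m γ) := by
  apply Finite.injective_iff_bijective.mp
  intro A B h
  have h' : FixedDetMatrices.reduce (mulRight A.1 γ) = FixedDetMatrices.reduce (mulRight B.1 γ) :=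
    congrArg Subtype.val h
  obtain ⟨α, hα⟩ := exists_reduce_eq_smul (mulRight A.1 γ)
  obtain ⟨β, hβ⟩ := exists_reduce_eq_smul (mulRight B.1 γ)
  rw [hα, hβ] at h'
  apply Subtype.ext
  refine reps_unique A.2 B.2 (α⁻¹ * β) ?_
  have h2 : mulRight A.1 γ = (α⁻¹ * β) • mulRight B.1 γ := by
    rw [mul_smul, ← h', inv_smul_smul]
  have h3 : A.1.1 * γ.1 = ((α⁻¹ * β).1 * B.1.1) * γ.1 := by
    rw [mul_assoc]
    exact congrArg Subtype.val h2
  apply Subtype.ext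
  have h4 := congrArg (fun M ↦ M * (γ⁻¹).1) h3
  have h5 : γ.1 * (γ⁻¹).1 = 1 := congrArg Subtype.val (mul_inv_cancel γ)
  rw [FixedDetMatrices.smul_coe]
  simpa only [mul_assoc, h5, mul_one] using h4

theorem heckeFun_slash {k : ℤ} (m : ℕ+) (f : CuspForm 𝒮ℒ k) (γ : SL(2, ℤ)) :
    heckeFun k m f ∣[k] (Matrix.SpecialLinearGroup.mapGL ℝ γ) = heckeFun k m f := by
  rw [heckeFun, SlashAction.sum_slash]
  refine Fintype.sum_bijective (repsMap m γ) (repsMap_bijective m γ) _ _ fun A ↦ ?_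
  obtain ⟨α, hα⟩ := exists_reduce_eq_smul (mulRight A.1 γ)
  have hf : (f : UpperHalfPlane → ℂ) ∣[k] (Matrix.SpecialLinearGroup.mapGL ℝ α) = f :=
    f.slash_action_eq' _ ⟨α, rfl⟩
  simp only [repsMap]
  rw [hα, toGL_smul, toGL_mulRight, SlashAction.slash_mul, hf, SlashAction.slash_mul]

theorem toGL_zero_at_infty {k : ℤ} {m : ℕ+} (f : CuspForm 𝒮ℒ k)
    {A : FixedDetMatrix (Fin 2) ℤ (m : ℤ)} (hA : A ∈ FixedDetMatrices.reps (m : ℤ)) :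
    UpperHalfPlane.IsZeroAtImInfty ((f : UpperHalfPlane → ℂ) ∣[k] (toGL A)) := by
  refine UpperHalfPlane.IsZeroAtImInfty.slash k ?_ (CuspFormClass.zero_at_infty f)
  simp [toGL, hA.1]

theorem heckeFun_zero_at_infty {k : ℤ} (m : ℕ+) (f : CuspForm 𝒮ℒ k) :
    UpperHalfPlane.IsZeroAtImInfty (heckeFun k m f) := by
  rw [heckeFun]
  refine Finset.sum_induction _ UpperHalfPlane.IsZeroAtImInfty (fun a b ha hb ↦ ?_) ?_
    fun A _ ↦ toGL_zero_at_infty f A.2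
  · exact Filter.ZeroAtFilter.add ha hb
  · exact Filter.zero_zeroAtFilter _

theorem heckeFun_mdifferentiable {k : ℤ} (m : ℕ+) (f : CuspForm 𝒮ℒ k) :
    MDiff (heckeFun k m f) := by
  rw [heckeFun]
  refine Finset.sum_induction _ (fun g : UpperHalfPlane → ℂ ↦ MDiff g)
    (fun a b ha hb ↦ ha.add hb) ?_ fun A _ ↦ f.holo'.slash k _
  exact mdifferentiable_const

/-- The Hecke operator `T_m` on the space `S_k` of cusp forms of weight `k` for `SL₂(ℤ)`. -/
def heckeT (k : ℤ) (m : ℕ+) : CuspForm 𝒮ℒ k →ₗ[ℂ] CuspForm 𝒮ℒ k where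
  toFun f :=
    { toFun := heckeFun k m f
      slash_action_eq' := by
        rintro _ ⟨γ, rfl⟩
        exact heckeFun_slash m f γ
      holo' := heckeFun_mdifferentiable m f
      zero_at_cusps' := fun hc ↦ by
        rw [OnePoint.isZeroAt_iff_forall_SL2Z hc]
        intro γ _
        rw [ModularForm.SL_slash]
        exact (heckeFun_slash m f γ).symm ▸ heckeFun_zero_at_infty m f }
  map_add' f g := by
    apply DFunLike.coe_injective
    change heckeFun k m (⇑f + ⇑g) = heckeFun k m f + heckeFun k m g
    simp only [heckeFun, SlashAction.add_slash, Finset.sum_add_distrib]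
  map_smul' c f := by
    apply DFunLike.coe_injective
    change heckeFun k m (c • ⇑f) = c • heckeFun k m f
    have h : ∀ A : FixedDetMatrix (Fin 2) ℤ (m : ℤ), UpperHalfPlane.σ (toGL A) c = c := fun A ↦ by
      have hpos : 0 < (toGL A).det.val := by
        have h : (A.1.map (Int.cast : ℤ → ℝ)).det = ((A.1.det : ℤ) : ℝ) :=
          (Int.cast_det A.1).symm
        change 0 < (A.1.map (Int.cast : ℤ → ℝ)).det
        rw [h, A.2]
        exact_mod_cast m.pos
      rw [UpperHalfPlane.σ, if_pos hpos]
      rfl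
    simp only [heckeFun, ModularForm.smul_slash, h, Finset.smul_sum]

/-- A (nonzero) cuspidal Hecke eigenform of weight `k` for `SL₂(ℤ)`: a simultaneous eigenvector of
all Hecke operators `T_m`, `m ≥ 1`. It is not assumed to be normalised. -/
def IsEigenform {k : ℤ} (f : CuspForm 𝒮ℒ k) : Prop :=
  f ≠ 0 ∧ ∀ m : ℕ+, ∃ t : ℂ, heckeT k m f = t • f

/-! ### Maeda's conjecture -/

/-- The `ℚ`-algebra structure on the endomorphisms of `S_k` underlying the `ℂ`-algebra structure. -/
instance instAlgebraRatEnd (k : ℤ) : Algebra ℚ (Module.End ℂ (CuspForm 𝒮ℒ k)) :=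
  Algebra.compHom _ (algebraMap ℚ ℂ)

/-- The Hecke algebra of `S_k` over `ℚ`: the `ℚ`-subalgebra of the `ℂ`-linear endomorphisms of
`S_k` generated by all `T_m`, `m ≥ 1`. -/
def heckeAlgebra (k : ℤ) : Subalgebra ℚ (Module.End ℂ (CuspForm 𝒮ℒ k)) :=
  Algebra.adjoin ℚ (Set.range (heckeT k))

/-- Maeda's conjecture for `S_k`: the Hecke algebra of `S_k` over `ℚ` is (isomorphic to) a single
number field `K`, and the Galois closure of `K` over `ℚ`, taken inside `ℂ`, has Galois group
isomorphic to the symmetric group on `dim S_k` letters. -/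
def MaedaConjecture (k : ℤ) : Prop :=
  ∃ (K : Type) (_ : Field K) (_ : NumberField K),
    Nonempty (heckeAlgebra k ≃ₐ[ℚ] K) ∧
    Nonempty (Gal(IntermediateField.normalClosure ℚ K ℂ/ℚ) ≃*
      Equiv.Perm (Fin (Module.finrank ℂ (CuspForm 𝒮ℒ k))))

/-! ### The forms of the two exceptional identities -/

/-- The Eisenstein series `E₁₂ = 1 + (65520/691) ∑ σ₁₁(n) qⁿ`. -/
def eisenstein12 : ModularForm 𝒮ℒ 12 := ModularForm.E (k := 12) (by norm_num)

/-- The cusp form `E₁₂ Δ + (12 r + 324204/691) Δ²` of weight 24. -/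
def form24 (r : ℂ) : CuspForm 𝒮ℒ 24 :=
  CuspForm.mcast (by norm_num) (CuspForm.discriminant.mulModularForm eisenstein12) +
    (12 * r + 324204 / 691) •
      CuspForm.mcast (by norm_num)
        (CuspForm.discriminant.mulModularForm (CuspForm.discriminant : ModularForm 𝒮ℒ 12))

/-- The cusp form `E₄ Δ` of weight 16. -/
def form16 : CuspForm 𝒮ℒ 16 :=
  CuspForm.mcast (by norm_num) (CuspForm.discriminant.mulModularForm ModularForm.E₄)

/-- The cusp form `Δ (x E₄⁵ + (1 - x) E₄² E₆²)` of weight 32, with `x = (12 r + 20532) / 1728`. -/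
def form32 (r : ℂ) : CuspForm 𝒮ℒ 32 :=
  ((12 * r + 20532) / 1728) •
      CuspForm.mcast (by norm_num)
        (CuspForm.discriminant.mulModularForm (ModularForm.E₄.pow 5)) +
    (1 - (12 * r + 20532) / 1728) •
      CuspForm.mcast (by norm_num) (CuspForm.discriminant.mulModularForm
        ((ModularForm.E₄.pow 2).mul (ModularForm.E₆.pow 2)))

end HeckeSquare

end

open scoped MatrixGroups ModularForm Manifold

noncomputable section

namespace HeckeSquare

open UpperHalfPlane Function EisensteinSeries

/-! ### Fourier coefficients of cusp forms -/

/-! Under Maeda's conjecture, the Hecke fields K₁ and K₂ of weights k and 2k are number fields, and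
the normalised eigenforms are indexed by their embeddings into ℂ (`exists_isEigenBasis`).
Automorphisms of ℂ act on q-expansions of level one forms, commute with the Hecke operators and
permute the eigenforms as they permute the embeddings. The symmetric Galois group makes them induce
every permutation of the embeddings of K₂ (`permEmbeddings_surjective`).

Let N be the group of automorphisms fixing every embedding of K₁, hence fixing a normalised f. The
image of N in Sym(Hom(K₂, ℂ)) is normal. It is nontrivial, since otherwise (dim S_{2k})! would
divide (dim S_k)!, although dim S_k < dim S_{2k}. A nontrivial normal subgroup of a symmetric group
is transitive (`exists_mem_ker_permEmbeddings`). As N fixes f², it permutes the coordinates of f² in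
the eigenbasis up to conjugation, so one nonzero coordinate makes all of them nonzero.

A two-term identity thus needs dim S_{2k} = 2, which leaves k = 12 and k = 16. There dim S_k = 1,
and S_{2k} has two eigenlines, found from the eigenvalue equation of T₂ and the Sturm bound. -/

/-- The `n`-th Fourier coefficient of a cusp form for `SL₂(ℤ)`, as a linear functional. -/
def fourierCoeff {k : ℤ} (n : ℕ) : CuspForm 𝒮ℒ k →ₗ[ℂ] ℂ where
  toFun f := (qExpansion 1 f).coeff n
  map_add' f g := by
    rw [show ⇑(f + g) = ⇑f + ⇑g from rfl,
      ModularForm.qExpansion_add one_pos one_mem_strictPeriods_SL, map_add]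
  map_smul' c f := by
    rw [show ⇑(c • f) = c • ⇑f from rfl,
      ModularForm.qExpansion_smul one_pos one_mem_strictPeriods_SL, PowerSeries.coeff_smul]
    rfl

theorem fourierCoeff_apply {k : ℤ} (n : ℕ) (f : CuspForm 𝒮ℒ k) :
    fourierCoeff n f = (qExpansion 1 f).coeff n := rfl

theorem fourierCoeff_zero {k : ℤ} (f : CuspForm 𝒮ℒ k) : fourierCoeff 0 f = 0 :=
  CuspFormClass.qExpansion_coeff_zero f one_pos one_mem_strictPeriods_SL

theorem cuspForm_ext_of_qExpansion {k : ℤ} {f g : CuspForm 𝒮ℒ k}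
    (h : qExpansion 1 f = qExpansion 1 g) : f = g := by
  have h1 : qExpansion 1 (CuspForm.toModularFormₗ (f - g)) = 0 := by
    rw [show ⇑(CuspForm.toModularFormₗ (f - g)) = ⇑f - ⇑g from rfl,
      ModularForm.qExpansion_sub one_pos one_mem_strictPeriods_SL, h, sub_self]
  rw [ModularForm.qExpansion_eq_zero_iff one_pos one_mem_strictPeriods_SL] at h1
  exact sub_eq_zero.mp ((map_eq_zero_iff _ CuspForm.toModularFormₗ_injective).mp h1)

theorem cuspForm_ext_of_fourierCoeff {k : ℤ} {f g : CuspForm 𝒮ℒ k}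
    (h : ∀ n : ℕ, n ≠ 0 → fourierCoeff n f = fourierCoeff n g) : f = g := by
  refine cuspForm_ext_of_qExpansion (PowerSeries.ext fun n ↦ ?_)
  rcases eq_or_ne n 0 with rfl | hn
  · exact (fourierCoeff_zero f).trans (fourierCoeff_zero g).symm
  · exact h n hn

/-! ### The action of the Hecke operators on Fourier coefficients -/

theorem sum_reps {M : Type*} [AddCommMonoid M] (m : ℕ+) (G : ℤ → ℤ → ℤ → M) :
    ∑ A : FixedDetMatrices.reps (m : ℤ), G (A.1.1 0 0) (A.1.1 0 1) (A.1.1 1 1) =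
      ∑ p ∈ (m : ℕ).divisorsAntidiagonal, ∑ b ∈ Finset.range p.2, G p.1 b p.2 := by
  rw [Finset.sum_sigma']
  have key : ∀ A : FixedDetMatrices.reps (m : ℤ), 0 < A.1.1 0 0 ∧ 0 ≤ A.1.1 0 1 ∧
      A.1.1 0 1 < A.1.1 1 1 ∧ A.1.1 0 0 * A.1.1 1 1 = (m : ℤ) := fun A ↦ by
    obtain ⟨h10, h00, h01, h11⟩ := A.2
    have hd := A.1.2
    rw [Matrix.det_fin_two, h10, mul_zero, sub_zero] at hd
    have hm : (0 : ℤ) < m := by exact_mod_cast m.pos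
    have : 0 < A.1.1 1 1 := by
      by_contra hneg
      nlinarith
    rw [abs_of_nonneg h01, abs_of_pos this] at h11
    exact ⟨h00, h01, h11, hd⟩
  refine Finset.sum_bij (fun A _ ↦ ⟨((A.1.1 0 0).toNat, (A.1.1 1 1).toNat), (A.1.1 0 1).toNat⟩)
    ?_ ?_ ?_ ?_
  · intro A _
    obtain ⟨h1, h2, h3, h4⟩ := key A
    simp only [Finset.mem_sigma, Nat.mem_divisorsAntidiagonal, Finset.mem_range]
    refine ⟨⟨?_, m.pos.ne'⟩, by omega⟩
    zify
    rw [Int.toNat_of_nonneg h1.le, Int.toNat_of_nonneg (by omega)]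
    exact h4
  · intro A _ B _ h
    obtain ⟨h1, h2, h3, h4⟩ := key A
    obtain ⟨h1', h2', h3', h4'⟩ := key B
    simp only [Sigma.mk.injEq, Prod.mk.injEq, heq_eq_eq] at h
    apply Subtype.ext
    ext i j
    fin_cases i <;> fin_cases j
    · simp only [Fin.zero_eta]; omega
    · simp only [Fin.zero_eta, Fin.mk_one]; omega
    · exact A.2.1.trans B.2.1.symm
    · simp only [Fin.mk_one]; omega
  · rintro ⟨⟨a, d⟩, b⟩ h
    simp only [Finset.mem_sigma, Nat.mem_divisorsAntidiagonal, Finset.mem_range] at h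
    obtain ⟨⟨had, hm⟩, hb⟩ := h
    have ha : a ≠ 0 := by rintro rfl; simp at had; omega
    refine ⟨⟨⟨!![(a : ℤ), b; 0, d], ?_⟩, ?_⟩, Finset.mem_univ _, ?_⟩
    · rw [Matrix.det_fin_two_of, mul_zero, sub_zero]
      exact_mod_cast had
    · refine ⟨rfl, ?_, ?_, ?_⟩
      · simpa using Nat.pos_of_ne_zero ha
      · simp
      · simpa using hb
    · simp
  · intro A _
    obtain ⟨h1, h2, h3, h4⟩ := key A
    simp only
    rw [Int.toNat_of_nonneg h1.le, Int.toNat_of_nonneg h2, Int.toNat_of_nonneg (by omega)]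

theorem slash_toGL_apply (k : ℤ) {m : ℕ+} (f : ℍ → ℂ)
    {A : FixedDetMatrix (Fin 2) ℤ (m : ℤ)} (hA : A ∈ FixedDetMatrices.reps (m : ℤ)) (z : ℍ) :
    (f ∣[k] toGL A) z = (m : ℂ) ^ (k - 1) * (A.1 1 1 : ℂ) ^ (-k) *
      f (ofComplex ((A.1 0 0 * z + A.1 0 1) / A.1 1 1)) := by
  have hdet : (toGL A).det.val = (m : ℝ) := by
    have h : (A.1.map (Int.cast : ℤ → ℝ)).det = ((A.1.det : ℤ) : ℝ) := (Int.cast_det A.1).symm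
    change (A.1.map (Int.cast : ℤ → ℝ)).det = _
    rw [h, A.2]
    simp
  have hpos : 0 < (toGL A).det.val := by rw [hdet]; exact_mod_cast m.pos
  have hden : denom (toGL A) z = (A.1 1 1 : ℂ) := by simp [denom, toGL, hA.1]
  have hnum : num (toGL A) z = (A.1 0 0 * z + A.1 0 1 : ℂ) := by simp [num, toGL]
  have hσ : ∀ w : ℂ, σ (toGL A) w = w := fun w ↦ by rw [σ, if_pos hpos]; rfl
  have hpt : ofComplex ((A.1 0 0 * z + A.1 0 1) / A.1 1 1) = toGL A • z := by
    rw [← hden, ← hnum, ← coe_smul_of_det_pos hpos z, ofComplex_apply]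
  rw [ModularForm.slash_apply, hσ, hpt, hden, hdet, abs_of_pos (by exact_mod_cast m.pos)]
  push_cast
  ring

theorem sum_range_exp_pow (d : ℕ) (hd : d ≠ 0) (n : ℕ) :
    ∑ b ∈ Finset.range d, Complex.exp (2 * Real.pi * Complex.I * b / d) ^ n =
      if d ∣ n then (d : ℂ) else 0 := by
  have hζ := Complex.isPrimitiveRoot_exp d hd
  set ζ := Complex.exp (2 * Real.pi * Complex.I / d)
  have h1 : ∀ b : ℕ, Complex.exp (2 * Real.pi * Complex.I * b / d) ^ n = (ζ ^ n) ^ b := fun b ↦ by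
    rw [show 2 * Real.pi * Complex.I * b / d = b * (2 * Real.pi * Complex.I / d) by ring,
      Complex.exp_nat_mul, ← pow_mul, ← pow_mul, mul_comm b n]
  simp_rw [h1]
  split_ifs with h
  · rw [(hζ.pow_eq_one_iff_dvd n).mpr h]
    simp
  · have h2 : ζ ^ n - 1 ≠ 0 := sub_ne_zero.mpr fun h2 ↦ h ((hζ.pow_eq_one_iff_dvd n).mp h2)
    have h3 := geom_sum_mul (ζ ^ n) d
    rw [← pow_mul, mul_comm n d, pow_mul, hζ.pow_eq_one, one_pow, sub_self] at h3
    exact (mul_eq_zero.mp h3).resolve_right h2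

/-- Summing over b kills every term q^(an/d) with d ∤ n; a surviving n = dl contributes
d·c(dl)·q^(al). -/
theorem hasSum_sum_translates {c : ℕ → ℂ} {F : ℍ → ℂ}
    (hF : ∀ τ : ℍ, HasSum (fun n ↦ c n * Periodic.qParam 1 τ ^ n) (F τ))
    {a d : ℕ} (ha : a ≠ 0) (hd : d ≠ 0) (z : ℍ) :
    HasSum (fun n ↦ (if a ∣ n then d * c (d * (n / a)) else 0) * Periodic.qParam 1 z ^ n)
      (∑ b ∈ Finset.range d, F (ofComplex ((a * z + b) / d))) := by
  have hd' : (d : ℂ) ≠ 0 := by exact_mod_cast hd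
  have him : ∀ b : ℕ, 0 < ((a * z + b) / d : ℂ).im := fun b ↦ by
    rw [Complex.div_natCast_im]
    have : 0 < z.im := z.im_pos
    have ha' : (0 : ℝ) < a := by positivity
    have hd'' : (0 : ℝ) < d := by positivity
    simp only [Complex.add_im, Complex.mul_im, Complex.natCast_re, Complex.natCast_im, zero_mul,
      add_zero, coe_im]
    positivity
  have h1 : HasSum (fun n ↦ ∑ b ∈ Finset.range d, c n *
      Periodic.qParam 1 (ofComplex ((a * z + b) / d) : ℍ) ^ n)
      (∑ b ∈ Finset.range d, F (ofComplex ((a * z + b) / d))) :=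
    hasSum_sum fun b _ ↦ hF _
  have h2 : ∀ n, ∑ b ∈ Finset.range d, c n *
      Periodic.qParam 1 (ofComplex ((a * z + b) / d) : ℍ) ^ n =
      c n * Complex.exp (2 * Real.pi * Complex.I * (a * z / d)) ^ n *
        if d ∣ n then (d : ℂ) else 0 := fun n ↦ by
    rw [← sum_range_exp_pow d hd, Finset.mul_sum]
    refine Finset.sum_congr rfl fun b _ ↦ ?_
    rw [ofComplex_apply_of_im_pos (him b), mul_assoc, ← mul_pow, ← Complex.exp_add,
      Periodic.qParam]
    congr 3
    change _ * ((a * z + b) / d : ℂ) / _ = _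
    push_cast
    ring
  simp_rw [h2] at h1
  -- Both series are supported on multiples, of d and of a respectively; they are compared through
  -- the common index l.
  have hinj : Injective (fun l : ℕ ↦ d * l) := fun x y h ↦ Nat.eq_of_mul_eq_mul_left
    (Nat.pos_of_ne_zero hd) h
  have hinj' : Injective (fun l : ℕ ↦ a * l) := fun x y h ↦ Nat.eq_of_mul_eq_mul_left
    (Nat.pos_of_ne_zero ha) h
  rw [← hinj.hasSum_iff] at h1
  · rw [← hinj'.hasSum_iff]
    · convert h1 using 1
      funext l
      simp only [comp_apply, dvd_mul_right, if_true,
        Nat.mul_div_cancel_left _ (Nat.pos_of_ne_zero ha), Periodic.qParam, ← Complex.exp_nat_mul]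
      rw [mul_comm (d : ℂ), mul_right_comm]
      congr 3
      push_cast
      field_simp
    · intro n hn
      rw [if_neg, zero_mul]
      rintro ⟨l, rfl⟩
      exact hn ⟨l, rfl⟩
  · intro n hn
    rw [if_neg, mul_zero]
    rintro ⟨l, rfl⟩
    exact hn ⟨l, rfl⟩

/-- The Fourier coefficients of `T_m f`. -/
theorem fourierCoeff_heckeT {k : ℤ} (m : ℕ+) (f : CuspForm 𝒮ℒ k) (n : ℕ) :
    fourierCoeff n (heckeT k m f) = ∑ p ∈ (m : ℕ).divisorsAntidiagonal,
      if p.1 ∣ n then (p.1 : ℂ) ^ (k - 1) * fourierCoeff (p.2 * (n / p.1)) f else 0 := by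
  refine (ModularFormClass.qExpansion_coeff_unique one_pos one_mem_strictPeriods_SL
    (f := heckeT k m f) (c := fun n ↦ ∑ p ∈ (m : ℕ).divisorsAntidiagonal,
      if p.1 ∣ n then (p.1 : ℂ) ^ (k - 1) * fourierCoeff (p.2 * (n / p.1)) f else 0)
    (fun z ↦ ?_) n).symm
  have hval : heckeT k m f z = ∑ p ∈ (m : ℕ).divisorsAntidiagonal,
      (m : ℂ) ^ (k - 1) * (p.2 : ℂ) ^ (-k) *
        ∑ b ∈ Finset.range p.2, f (ofComplex ((p.1 * z + b) / p.2)) := by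
    change (∑ A : FixedDetMatrices.reps (m : ℤ), (f : ℍ → ℂ) ∣[k] (toGL A.1)) z = _
    rw [Finset.sum_apply]
    simp_rw [fun A : FixedDetMatrices.reps (m : ℤ) ↦ slash_toGL_apply k (f : ℍ → ℂ) A.2 z]
    rw [sum_reps m (fun a b d ↦ (m : ℂ) ^ (k - 1) * (d : ℂ) ^ (-k) *
      f (ofComplex ((a * z + b) / d)))]
    simp_rw [Finset.mul_sum, Int.cast_natCast]
  rw [hval]
  simp_rw [Finset.sum_smul]
  refine hasSum_sum fun p hp ↦ ?_
  obtain ⟨hp, hm⟩ := Nat.mem_divisorsAntidiagonal.mp hp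
  have hp1 : p.1 ≠ 0 := by rintro h; rw [h, zero_mul] at hp; exact hm hp.symm
  have hp2 : p.2 ≠ 0 := by rintro h; rw [h, mul_zero] at hp; exact hm hp.symm
  have h := (hasSum_sum_translates (fun τ ↦ ModularForm.hasSum_qExpansion f one_pos
    one_mem_strictPeriods_SL τ) hp1 hp2 z).mul_left ((m : ℂ) ^ (k - 1) * (p.2 : ℂ) ^ (-k))
  refine (congrArg (HasSum · _) (funext fun n ↦ ?_)).mpr h
  have hp1' : (p.1 : ℂ) ≠ 0 := by exact_mod_cast hp1
  have hp2' : (p.2 : ℂ) ≠ 0 := by exact_mod_cast hp2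
  -- With m = ad, the factor m^(k-1) d^(-k) times the d from the character sum is a^(k-1).
  have hmp : (m : ℂ) = p.1 * p.2 := by exact_mod_cast hp.symm
  split_ifs with hn
  · rw [smul_eq_mul, fourierCoeff_apply, hmp, mul_zpow, zpow_sub_one₀ hp2', zpow_neg]
    field_simp
  · simp

/-- Only a = 1 divides 1. This is the source of multiplicity one: eigenvalues and the first
coefficient determine an eigenform. -/
theorem fourierCoeff_one_heckeT {k : ℤ} (m : ℕ+) (f : CuspForm 𝒮ℒ k) :
    fourierCoeff 1 (heckeT k m f) = fourierCoeff m f := by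
  rw [fourierCoeff_heckeT, Finset.sum_eq_single (1, (m : ℕ))]
  · simp
  · rintro ⟨a, d⟩ hp hne
    rw [if_neg]
    intro h
    obtain rfl : a = 1 := Nat.dvd_one.mp h
    obtain ⟨hp, -⟩ := Nat.mem_divisorsAntidiagonal.mp hp
    exact hne (by simp_all)
  · intro h
    exact absurd (Nat.mem_divisorsAntidiagonal.mpr ⟨one_mul _, m.pos.ne'⟩) h

theorem fourierCoeff_two_heckeT_two {k : ℤ} (f : CuspForm 𝒮ℒ k) :
    fourierCoeff 2 (heckeT k 2 f) = fourierCoeff 4 f + 2 ^ (k - 1) * fourierCoeff 1 f := by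
  rw [fourierCoeff_heckeT, show ((2 : ℕ+) : ℕ).divisorsAntidiagonal = {(1, 2), (2, 1)} by decide,
    Finset.sum_pair (by decide)]
  simp

/-! ### Galois conjugation of modular forms -/

theorem qExpansion_E_map {k : ℕ} (hk : 3 ≤ k) (hk2 : Even k) (σ : ℂ →+* ℂ) :
    (qExpansion 1 (ModularForm.E hk)).map σ = qExpansion 1 (ModularForm.E hk) := by
  ext n
  rw [PowerSeries.coeff_map, E_qExpansion_coeff hk hk2]
  split_ifs
  · exact map_one σ
  · simp [map_ofNat σ 2]

theorem qExpansion_discriminant :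
    qExpansion 1 CuspForm.discriminant = (1 / 1728 : ℂ) •
      (qExpansion 1 ModularForm.E₄ ^ 3 - qExpansion 1 ModularForm.E₆ ^ 2) := by
  have h : (CuspForm.discriminant : ℍ → ℂ) = (1 / 1728 : ℂ) •
      (⇑(ModularForm.mcast (b := 12) (by norm_num) (ModularForm.E₄.pow 3)) -
        ⇑(ModularForm.mcast (b := 12) (by norm_num) (ModularForm.E₆.pow 2))) := by
    funext z
    rw [CuspForm.coe_discriminant, ModularForm.discriminant_eq_E₄_cube_sub_E₆_sq]
    simp only [ModularForm.coe_mcast, ModularForm.coe_pow, Pi.smul_apply, Pi.sub_apply,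
      Pi.pow_apply, smul_eq_mul]
    ring
  rw [h, ← FunLike.coe_sub, ModularForm.qExpansion_smul one_pos one_mem_strictPeriods_SL,
    FunLike.coe_sub, ModularForm.qExpansion_sub one_pos one_mem_strictPeriods_SL,
    ModularForm.qExpansion_mcast, ModularForm.qExpansion_mcast,
    ModularForm.qExpansion_pow one_pos one_mem_strictPeriods_SL,
    ModularForm.qExpansion_pow one_pos one_mem_strictPeriods_SL]

theorem powerSeries_map_smul (σ : ℂ →+* ℂ) (c : ℂ) (p : PowerSeries ℂ) :
    (c • p).map σ = σ c • p.map σ := by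
  ext n
  simp

theorem qExpansion_discriminant_map (σ : ℂ →+* ℂ) :
    (qExpansion 1 CuspForm.discriminant).map σ = qExpansion 1 CuspForm.discriminant := by
  rw [qExpansion_discriminant, powerSeries_map_smul, map_sub, map_pow, map_pow,
    qExpansion_E_map _ ⟨2, rfl⟩, qExpansion_E_map _ ⟨3, rfl⟩, map_div₀, map_one,
    map_ofNat σ 1728]

theorem qExpansion_eq_discriminant_mul {k : ℤ} (f : CuspForm 𝒮ℒ k) :
    qExpansion 1 f = qExpansion 1 CuspForm.discriminant *
      qExpansion 1 (CuspForm.discriminantEquiv f) := by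
  rw [← ModularForm.discriminant_mul_discriminantEquiv f, ← CuspForm.coe_discriminant]
  exact ModularForm.qExpansion_mul_coe one_pos one_mem_strictPeriods_SL _ _

/-- Divide by Δ, whose coefficients are rational, conjugate the quotient in weight k - 12, and
multiply back. -/
theorem exists_cuspForm_conj_of_modularForm {k : ℤ} (σ : ℂ →+* ℂ)
    (h : ∀ f : ModularForm 𝒮ℒ (k - 12), ∃ g : ModularForm 𝒮ℒ (k - 12),
      qExpansion 1 g = (qExpansion 1 f).map σ) (f : CuspForm 𝒮ℒ k) :
    ∃ g : CuspForm 𝒮ℒ k, qExpansion 1 g = (qExpansion 1 f).map σ := by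
  obtain ⟨g, hg⟩ := h (CuspForm.discriminantEquiv f)
  refine ⟨CuspForm.discriminantEquiv.symm g, ?_⟩
  rw [qExpansion_eq_discriminant_mul f, qExpansion_eq_discriminant_mul, map_mul,
    LinearEquiv.apply_symm_apply, hg, qExpansion_discriminant_map]

theorem exists_conj_of_exists_unit {k : ℤ} (σ : ℂ →+* ℂ)
    (h : ∀ f : CuspForm 𝒮ℒ k, ∃ g : CuspForm 𝒮ℒ k, qExpansion 1 g = (qExpansion 1 f).map σ)
    (e : ModularForm 𝒮ℒ k) (he : (qExpansion 1 e).map σ = qExpansion 1 e)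
    (he0 : (qExpansion 1 e).coeff 0 = 1) (f : ModularForm 𝒮ℒ k) :
    ∃ g : ModularForm 𝒮ℒ k, qExpansion 1 g = (qExpansion 1 f).map σ := by
  obtain ⟨f₀, hf₀⟩ := ModularForm.sub_smul_isCuspForm f e he0
  obtain ⟨g₀, hg₀⟩ := h f₀
  set c := (qExpansion 1 f).coeff 0
  have hf : (f₀ : ℍ → ℂ) = f - c • e := congrArg DFunLike.coe hf₀
  refine ⟨CuspForm.toModularFormₗ g₀ + σ c • e, ?_⟩
  rw [FunLike.coe_add, ModularForm.qExpansion_add one_pos one_mem_strictPeriods_SL,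
    FunLike.coe_smul, ModularForm.qExpansion_smul one_pos one_mem_strictPeriods_SL,
    show (CuspForm.toModularFormₗ g₀ : ℍ → ℂ) = g₀ from rfl, hg₀, hf, ← FunLike.coe_smul,
    ModularForm.qExpansion_sub one_pos one_mem_strictPeriods_SL, FunLike.coe_smul,
    ModularForm.qExpansion_smul one_pos one_mem_strictPeriods_SL, map_sub, powerSeries_map_smul, he,
    sub_add_cancel]

/-- Induction on the weight: subtracting a multiple of a form with rational coefficients and
constant term 1 (E_k, or 1 in weight 0) leaves a cusp form, which is Δ times a form of weight k -
12. -/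
theorem exists_modularForm_conj (σ : ℂ →+* ℂ) {k : ℤ} (f : ModularForm 𝒮ℒ k) :
    ∃ g : ModularForm 𝒮ℒ k, qExpansion 1 g = (qExpansion 1 f).map σ := by
  suffices H : ∀ n : ℕ, ∀ k : ℤ, k < n → ∀ f : ModularForm 𝒮ℒ k,
      ∃ g : ModularForm 𝒮ℒ k, qExpansion 1 g = (qExpansion 1 f).map σ from
    H (k.toNat + 1) k (by omega) f
  intro n
  induction n with
  | zero =>
    intro k hk f
    refine ⟨0, ?_⟩
    rw [ModularFormClass.levelOne_neg_weight_eq_zero (by simpa using hk) f]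
    simp [qExpansion_zero]
  | succ n ih =>
    intro k hk f
    have hcusp := fun f ↦ exists_cuspForm_conj_of_modularForm (k := k) σ
      (ih (k - 12) (by push_cast at hk; omega)) f
    have hzero : f = 0 → ∃ g : ModularForm 𝒮ℒ k, qExpansion 1 g = (qExpansion 1 f).map σ := by
      rintro rfl
      exact ⟨0, by simp [qExpansion_zero]⟩
    rcases lt_or_ge k 0 with hneg | hnonneg
    · exact hzero (DFunLike.coe_injective (ModularFormClass.levelOne_neg_weight_eq_zero hneg f))
    rcases Int.even_or_odd k with heven | hodd
    swap
    · exact hzero (ModularForm.levelOne_odd_weight_eq_zero hodd f)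
    lift k to ℕ using hnonneg
    have heven' : Even k := by exact_mod_cast heven
    rcases Nat.lt_or_ge k 3 with h3 | h3
    · interval_cases k
      · refine exists_conj_of_exists_unit σ hcusp ((1 : ModularForm 𝒮ℒ 0)) ?_ ?_ f
        · rw [ModularForm.qExpansion_one, map_one]
        · rw [ModularForm.qExpansion_one, PowerSeries.coeff_zero_one]
      · exact absurd heven' (by decide)
      · exact hzero (rank_zero_iff_forall_zero.mp ModularForm.levelOne_weight_two_rank_zero f)
    · exact exists_conj_of_exists_unit σ hcusp (ModularForm.E h3) (qExpansion_E_map h3 heven' σ)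
        (E_qExpansion_coeff_zero h3 heven') f

theorem exists_cuspForm_conj (σ : ℂ →+* ℂ) {k : ℤ} (f : CuspForm 𝒮ℒ k) :
    ∃ g : CuspForm 𝒮ℒ k, ∀ n, fourierCoeff n g = σ (fourierCoeff n f) := by
  obtain ⟨g, hg⟩ := exists_cuspForm_conj_of_modularForm σ (exists_modularForm_conj σ) f
  exact ⟨g, fun n ↦ by rw [fourierCoeff_apply, hg, PowerSeries.coeff_map, fourierCoeff_apply]⟩

theorem fourierCoeff_heckeT_conj (σ : ℂ →+* ℂ) {k : ℤ} {f g : CuspForm 𝒮ℒ k}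
    (h : ∀ n, fourierCoeff n g = σ (fourierCoeff n f)) (m : ℕ+) (n : ℕ) :
    fourierCoeff n (heckeT k m g) = σ (fourierCoeff n (heckeT k m f)) := by
  rw [fourierCoeff_heckeT, fourierCoeff_heckeT, map_sum]
  refine Finset.sum_congr rfl fun p _ ↦ ?_
  split_ifs
  · rw [h, map_mul, map_zpow₀, map_natCast]
  · rw [map_zero]

/-! ### Automorphisms of `ℂ` and permutation groups -/

/-- Let τ act on the coefficients of polynomials in a transcendence basis of C over F; C is an
algebraic closure of that polynomial ring, so the automorphism extends. -/
theorem exists_ringEquiv_extending (F : Type*) {C : Type*} [Field F] [Field C] [Algebra F C]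
    [IsAlgClosed C] (τ : F ≃+* F) :
    ∃ σ : C ≃+* C, ∀ x, σ (algebraMap F C x) = algebraMap F C (τ x) := by
  obtain ⟨s, hs⟩ := exists_isTranscendenceBasis F C
  let A := Algebra.adjoin F (Set.range ((↑) : s → C))
  let e : A ≃+* A := (hs.1.aevalEquiv.symm.toRingEquiv.trans
    (MvPolynomial.mapEquiv s τ)).trans hs.1.aevalEquiv.toRingEquiv
  let : IsAlgClosure A C := IsAlgClosed.isAlgClosure_of_transcendence_basis _ hs
  refine ⟨IsAlgClosure.equivOfEquiv C C e, fun x ↦ ?_⟩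
  have h1 : e (algebraMap F A x) = algebraMap F A (τ x) := by
    have : hs.1.aevalEquiv.symm (algebraMap F A x) = MvPolynomial.C x := by
      rw [AlgEquiv.commutes]; rfl
    have h2 : hs.1.aevalEquiv (MvPolynomial.C (τ x)) = algebraMap F A (τ x) :=
      hs.1.aevalEquiv.commutes (τ x)
    change hs.1.aevalEquiv (MvPolynomial.map (τ : F →+* F)
      (hs.1.aevalEquiv.symm (algebraMap F A x))) = _
    rw [this, MvPolynomial.map_C]
    exact h2
  rw [IsScalarTower.algebraMap_apply F A C, IsAlgClosure.equivOfEquiv_algebraMap, h1]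
  rfl

/-- The automorphisms of an algebraically closed extension `C` of `F` act transitively on the
embeddings into `C` of an algebraic extension of `F`. -/
theorem exists_ringEquiv_comp_eq {F K C : Type*} [Field F] [Field K] [Field C]
    [Algebra F K] [Algebra F C] [IsAlgClosed C] [Algebra.IsAlgebraic F K]
    (φ ψ : K →ₐ[F] C) : ∃ σ : C ≃+* C, ∀ x, σ (φ x) = ψ x := by
  let Q := algebraicClosure F C
  have hmem : ∀ (χ : K →ₐ[F] C) x, χ x ∈ Q := fun χ x ↦
    mem_algebraicClosure_iff.mpr <| (Algebra.IsAlgebraic.isAlgebraic (R := F) x).algHom χ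
  have : IsAlgClosure F Q := inferInstance
  have : Normal F Q := IsAlgClosure.normal F Q
  let φ' : K →ₐ[F] Q := φ.codRestrict Q.toSubalgebra (hmem φ)
  let ψ' : K →ₐ[F] Q := ψ.codRestrict Q.toSubalgebra (hmem ψ)
  -- Q is normal over F, so once K is embedded in it by φ', the map ψ' extends to an automorphism of
  -- Q.
  obtain ⟨τ, hτ⟩ : ∃ τ : Q ≃ₐ[F] Q, ∀ x, τ (φ' x) = ψ' x := by
    let : Algebra K Q := φ'.toRingHom.toAlgebra
    have : IsScalarTower F K Q := IsScalarTower.of_algebraMap_eq fun x ↦ (φ'.commutes x).symm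
    let χ : Q →ₐ[F] Q := ψ'.liftNormal Q
    refine ⟨AlgEquiv.ofBijective χ (AlgHom.normal_bijective F Q Q χ), fun x ↦ ?_⟩
    exact ψ'.liftNormal_commutes Q x
  obtain ⟨σ, hσ⟩ := exists_ringEquiv_extending Q (C := C) τ.toRingEquiv
  refine ⟨σ, fun x ↦ ?_⟩
  exact (hσ (φ' x)).trans (congrArg (algebraMap Q C) (hτ x))

theorem exists_perm_apply_apply {X : Type*} {a b x y : X} (hab : a ≠ b)
    (hxy : x ≠ y) : ∃ g : Equiv.Perm X, g a = x ∧ g b = y := by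
  classical
  -- The first swap sends a to x; the second moves the image of b to y and leaves x in place.
  refine ⟨Equiv.swap (Equiv.swap a x b) y * Equiv.swap a x, ?_, ?_⟩
  · rw [Equiv.Perm.mul_apply, Equiv.swap_apply_left, Equiv.swap_apply_of_ne_of_ne _ hxy]
    intro h
    have := (Equiv.swap a x).injective ((Equiv.swap_apply_left a x).trans h)
    exact hab this
  · rw [Equiv.Perm.mul_apply, Equiv.swap_apply_left]

/-- A nontrivial normal subgroup of a symmetric group acts transitively. -/
theorem exists_mem_apply_eq_of_normal {X : Type*} {H : Subgroup (Equiv.Perm X)} [H.Normal]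
    (hH : H ≠ ⊥) (x y : X) : ∃ h ∈ H, h x = y := by
  rcases eq_or_ne x y with rfl | hxy
  · exact ⟨1, H.one_mem, rfl⟩
  obtain ⟨⟨h, hh⟩, h1⟩ := H.ne_bot_iff_exists_ne_one.mp hH
  obtain ⟨a, ha⟩ : ∃ a, a ≠ h a := by
    by_contra! hcon
    exact h1 (Subtype.ext (Equiv.ext fun a ↦ (hcon a).symm))
  -- Choose g with g a = x and g (h a) = y; then the conjugate of h by g sends x to y.
  obtain ⟨g, rfl, rfl⟩ := exists_perm_apply_apply ha hxy
  exact ⟨g * h * g⁻¹, ‹H.Normal›.conj_mem h hh g, by simp⟩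

/-! ### Eigenforms and the embeddings of the Hecke field -/

instance finiteDimensional_cuspForm (k : ℤ) : FiniteDimensional ℂ (CuspForm 𝒮ℒ k) :=
  Module.Finite.equiv CuspForm.discriminantEquiv.symm

instance isScalarTower_end (k : ℤ) : IsScalarTower ℚ ℂ (Module.End ℂ (CuspForm 𝒮ℒ k)) :=
  IsScalarTower.of_algebraMap_eq fun _ ↦ rfl

section HeckeField

variable {k : ℤ} {K : Type} [Field K] [NumberField K] (e : heckeAlgebra k ≃ₐ[ℚ] K)

/-- The image of `T_m` in the Hecke field. -/
def heckeElement (m : ℕ+) : K :=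
  e ⟨heckeT k m, Algebra.subset_adjoin ⟨m, rfl⟩⟩

/-- The action of the Hecke field on the space of cusp forms. -/
def heckeAction : K →ₐ[ℚ] Module.End ℂ (CuspForm 𝒮ℒ k) :=
  (heckeAlgebra k).val.comp e.symm.toAlgHom

theorem heckeAction_heckeElement (m : ℕ+) : heckeAction e (heckeElement e m) = heckeT k m := by
  change ((e.symm (e _) : heckeAlgebra k) : Module.End ℂ (CuspForm 𝒮ℒ k)) = _
  rw [AlgEquiv.symm_apply_apply]

/-- Commutativity is inherited from the field K, so no double coset computation is needed. -/
theorem heckeT_comm (e : heckeAlgebra k ≃ₐ[ℚ] K) (m n : ℕ+) (f : CuspForm 𝒮ℒ k) :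
    heckeT k m (heckeT k n f) = heckeT k n (heckeT k m f) := by
  rw [← heckeAction_heckeElement e m, ← heckeAction_heckeElement e n, ← Module.End.mul_apply,
    ← map_mul, mul_comm, map_mul, Module.End.mul_apply]

theorem adjoin_range_heckeElement : Algebra.adjoin ℚ (Set.range (heckeElement e)) = ⊤ := by
  have h : Algebra.adjoin ℚ ((↑) ⁻¹' Set.range (heckeT k) : Set (heckeAlgebra k)) = ⊤ :=
    Algebra.adjoin_adjoin_coe_preimage
  have h2 := congrArg (Subalgebra.map e.toAlgHom) h
  rw [AlgHom.map_adjoin, Algebra.map_top] at h2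
  rw [eq_top_iff]
  intro x _
  have hx : x ∈ e.toAlgHom.range := ⟨e.symm x, e.apply_symm_apply x⟩
  rw [← h2] at hx
  refine Algebra.adjoin_mono ?_ hx
  rintro _ ⟨⟨T, hT⟩, ⟨m, rfl⟩, rfl⟩
  exact ⟨m, rfl⟩

theorem ringHom_ext_heckeElement {φ ψ : K →+* ℂ}
    (h : ∀ m, φ (heckeElement e m) = ψ (heckeElement e m)) : φ = ψ := by
  have h2 : φ.toRatAlgHom = ψ.toRatAlgHom :=
    AlgHom.ext_of_adjoin_eq_top (adjoin_range_heckeElement e) (by rintro _ ⟨m, rfl⟩; exact h m)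
  ext x
  exact DFunLike.congr_fun h2 x

/-- The elements of the Hecke field having `f` as an eigenvector. -/
def eigenSubalgebra (f : CuspForm 𝒮ℒ k) : Subalgebra ℚ K where
  carrier := {x | ∃ c : ℂ, heckeAction e x f = c • f}
  mul_mem' := by
    rintro x y ⟨c, hc⟩ ⟨d, hd⟩
    refine ⟨c * d, ?_⟩
    rw [map_mul, Module.End.mul_apply, hd, map_smul, hc, smul_smul, mul_comm]
  add_mem' := by
    rintro x y ⟨c, hc⟩ ⟨d, hd⟩
    refine ⟨c + d, ?_⟩
    rw [map_add, LinearMap.add_apply, hd, hc, add_smul]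
  algebraMap_mem' q := by
    refine ⟨algebraMap ℚ ℂ q, ?_⟩
    rw [AlgHom.commutes, IsScalarTower.algebraMap_apply ℚ ℂ, Module.algebraMap_end_apply]

/-- Since f ≠ 0, eigenvalues are unique, and uniqueness makes x ↦ eigenvalue additive and
multiplicative. -/
theorem exists_character {f : CuspForm 𝒮ℒ k} (hf : f ≠ 0) (h : eigenSubalgebra e f = ⊤) :
    ∃ φ : K →+* ℂ, ∀ x, heckeAction e x f = φ x • f := by
  have h' : ∀ x : K, ∃ c : ℂ, heckeAction e x f = c • f := fun x ↦
    (h ▸ Algebra.mem_top : x ∈ eigenSubalgebra e f)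
  choose φ hφ using h'
  have hinj := smul_left_injective ℂ hf
  refine ⟨⟨⟨⟨φ, ?_⟩, ?_⟩, ?_, ?_⟩, hφ⟩
  · apply hinj
    simp only [← hφ, map_one, Module.End.one_apply, one_smul]
  · intro x y
    apply hinj
    simp only [← hφ, map_mul, Module.End.mul_apply]
    rw [hφ y, map_smul, hφ x, smul_smul, mul_comm]
  · apply hinj
    simp only [← hφ, map_zero, LinearMap.zero_apply, zero_smul]
  · intro x y
    apply hinj
    simp only [← hφ, map_add, LinearMap.add_apply, add_smul]

theorem exists_character_of_isEigenform {f : CuspForm 𝒮ℒ k} (hf : IsEigenform f) :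
    ∃ φ : K →+* ℂ, ∀ x, heckeAction e x f = φ x • f := by
  refine exists_character e hf.1 (eq_top_iff.mpr ?_)
  rw [← adjoin_range_heckeElement e, Algebra.adjoin_le_iff]
  rintro _ ⟨m, rfl⟩
  obtain ⟨c, hc⟩ := hf.2 m
  exact ⟨c, by rw [heckeAction_heckeElement, hc]⟩

theorem isEigenform_of_character {f : CuspForm 𝒮ℒ k} (hf : f ≠ 0) {φ : K →+* ℂ}
    (h : ∀ m, heckeT k m f = φ (heckeElement e m) • f) : IsEigenform f :=
  ⟨hf, fun m ↦ ⟨_, h m⟩⟩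

theorem fourierCoeff_of_character {f : CuspForm 𝒮ℒ k} {φ : K →+* ℂ}
    (h : ∀ m, heckeT k m f = φ (heckeElement e m) • f) (m : ℕ+) :
    fourierCoeff m f = φ (heckeElement e m) * fourierCoeff 1 f := by
  rw [← fourierCoeff_one_heckeT, h, map_smul, smul_eq_mul]

theorem fourierCoeff_one_ne_zero_of_character {f : CuspForm 𝒮ℒ k} (hf : f ≠ 0) {φ : K →+* ℂ}
    (h : ∀ m, heckeT k m f = φ (heckeElement e m) • f) : fourierCoeff 1 f ≠ 0 := by
  intro h1
  refine hf (cuspForm_ext_of_fourierCoeff fun n hn ↦ ?_)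
  rw [map_zero]
  have := fourierCoeff_of_character e h ⟨n, Nat.pos_of_ne_zero hn⟩
  rwa [h1, mul_zero] at this

theorem exists_adjoin_singleton_eq_top (K : Type*) [Field K] [NumberField K] :
    ∃ θ : K, Algebra.adjoin ℚ {θ} = ⊤ :=
  ⟨_, (Field.powerBasisOfFiniteOfSeparable ℚ K).adjoin_gen_eq_top⟩

/-- The minimal polynomial of θ over ℚ is separable, hence squarefree over ℂ, and kills the action
of θ. This replaces the Petersson inner product. -/
theorem iSup_eigenspace_heckeAction (θ : K) :
    ⨆ μ : ℂ, (heckeAction e θ).eigenspace μ = ⊤ := by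
  apply Module.End.IsSemisimple.iSup_eigenspace_eq_top
  have hsep : ((minpoly ℚ θ).map (algebraMap ℚ ℂ)).Separable :=
    Polynomial.Separable.map (Algebra.IsSeparable.isSeparable ℚ θ)
  refine Module.End.isSemisimple_of_squarefree_aeval_eq_zero hsep.squarefree ?_
  rw [Polynomial.aeval_map_algebraMap, Polynomial.aeval_algHom_apply, minpoly.aeval, map_zero]

theorem exists_character_of_mem_eigenspace {θ : K} (hθ : Algebra.adjoin ℚ {θ} = ⊤)
    {f : CuspForm 𝒮ℒ k} (hf : f ≠ 0) {μ : ℂ} (h : f ∈ (heckeAction e θ).eigenspace μ) :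
    ∃ φ : K →+* ℂ, ∀ x, heckeAction e x f = φ x • f := by
  refine exists_character e hf (eq_top_iff.mpr ?_)
  rw [← hθ, Algebra.adjoin_le_iff, Set.singleton_subset_iff]
  exact ⟨μ, Module.End.mem_eigenspace_iff.mp h⟩

theorem exists_eigenvector [Nontrivial (CuspForm 𝒮ℒ k)] :
    ∃ (f : CuspForm 𝒮ℒ k) (φ : K →+* ℂ), f ≠ 0 ∧ ∀ x, heckeAction e x f = φ x • f := by
  obtain ⟨θ, hθ⟩ := exists_adjoin_singleton_eq_top K
  obtain ⟨μ, hμ⟩ := Module.End.exists_eigenvalue (heckeAction e θ)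
  obtain ⟨f, hf, hf0⟩ := hμ.exists_hasEigenvector
  obtain ⟨φ, hφ⟩ := exists_character_of_mem_eigenspace e hθ hf0 hf
  exact ⟨f, φ, hf0, hφ⟩

theorem heckeAction_of_character {f : CuspForm 𝒮ℒ k} (hf : f ≠ 0) {φ : K →+* ℂ}
    (h : ∀ m, heckeT k m f = φ (heckeElement e m) • f) (x : K) :
    heckeAction e x f = φ x • f := by
  obtain ⟨ψ, hψ⟩ := exists_character_of_isEigenform e (isEigenform_of_character e hf h)
  obtain rfl : ψ = φ := ringHom_ext_heckeElement e fun m ↦ smul_left_injective ℂ hf <| by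
    simp only [← hψ, ← h, heckeAction_heckeElement]
  exact hψ x

/-- Some eigenform exists, with some character ψ. An automorphism of ℂ carrying ψ to φ conjugates it
into an eigenform with character φ, so every embedding occurs. -/
theorem exists_normalised_eigenform [Nontrivial (CuspForm 𝒮ℒ k)] (φ : K →+* ℂ) :
    ∃ f : CuspForm 𝒮ℒ k, fourierCoeff 1 f = 1 ∧
      ∀ m, heckeT k m f = φ (heckeElement e m) • f := by
  obtain ⟨f, ψ, hf, hψ⟩ := exists_eigenvector e
  have hψ' : ∀ m, heckeT k m f = ψ (heckeElement e m) • f := fun m ↦ by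
    rw [← hψ, heckeAction_heckeElement]
  obtain ⟨σ, hσ⟩ := exists_ringEquiv_comp_eq ψ.toRatAlgHom φ.toRatAlgHom
  obtain ⟨g, hg⟩ := exists_cuspForm_conj (σ : ℂ →+* ℂ) f
  have h1 : fourierCoeff 1 g ≠ 0 := by
    rw [hg, map_ne_zero]
    exact fourierCoeff_one_ne_zero_of_character e hf hψ'
  have hgφ : ∀ m, heckeT k m g = φ (heckeElement e m) • g := fun m ↦ by
    refine cuspForm_ext_of_fourierCoeff fun n _ ↦ ?_
    rw [fourierCoeff_heckeT_conj (σ : ℂ →+* ℂ) hg, hψ', map_smul, smul_eq_mul, map_mul, ← hg,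
      map_smul, smul_eq_mul]
    congr 1
    exact hσ _
  refine ⟨(fourierCoeff 1 g)⁻¹ • g, ?_, fun m ↦ ?_⟩
  · rw [map_smul, smul_eq_mul, inv_mul_cancel₀ h1]
  · rw [map_smul, hgφ, smul_comm]

/-- A family of normalised eigenforms indexed by the embeddings of a number field `K`, which is a
basis of the space of cusp forms of weight `k`, and exhausts all eigenforms up to scaling. -/
structure IsEigenBasis (t : ℕ+ → K) (F : (K →+* ℂ) → CuspForm 𝒮ℒ k) : Prop where
  heckeT_apply : ∀ φ m, heckeT k m (F φ) = φ (t m) • F φ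
  fourierCoeff_one : ∀ φ, fourierCoeff 1 (F φ) = 1
  fourierCoeff_eq : ∀ φ (m : ℕ+), fourierCoeff m (F φ) = φ (t m)
  linearIndependent : LinearIndependent ℂ F
  span_eq_top : Submodule.span ℂ (Set.range F) = ⊤
  exists_eq_smul : ∀ f : CuspForm 𝒮ℒ k, IsEigenform f → ∃ (φ : K →+* ℂ) (c : ℂ), f = c • F φ

theorem exists_isEigenBasis [Nontrivial (CuspForm 𝒮ℒ k)] :
    ∃ F : (K →+* ℂ) → CuspForm 𝒮ℒ k, IsEigenBasis (heckeElement e) F := by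
  choose F hF1 hF using exists_normalised_eigenform e
  have hF0 : ∀ φ, F φ ≠ 0 := fun φ h ↦ by
    have := hF1 φ
    rw [h, map_zero] at this
    exact zero_ne_one this
  have hcoeff : ∀ φ (m : ℕ+), fourierCoeff m (F φ) = φ (heckeElement e m) := fun φ m ↦ by
    rw [fourierCoeff_of_character e (hF φ), hF1, mul_one]
  have hmul : ∀ f : CuspForm 𝒮ℒ k, f ≠ 0 → ∀ φ : K →+* ℂ, (∀ x, heckeAction e x f = φ x • f) →
      f = fourierCoeff 1 f • F φ := fun f hf φ h ↦ by
    refine cuspForm_ext_of_fourierCoeff fun n hn ↦ ?_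
    have h2 := fourierCoeff_of_character e (f := f) (φ := φ)
      (fun m ↦ by rw [← h, heckeAction_heckeElement]) ⟨n, Nat.pos_of_ne_zero hn⟩
    have h3 := hcoeff φ ⟨n, Nat.pos_of_ne_zero hn⟩
    rw [PNat.mk_coe] at h2 h3
    rw [h2, map_smul, h3, smul_eq_mul, mul_comm]
  obtain ⟨θ, hθ⟩ := exists_adjoin_singleton_eq_top K
  refine ⟨F, hF, hF1, hcoeff, ?_, ?_, ?_⟩
  -- An embedding is determined by its value at the generator θ, so the `F φ` belong to distinct
  -- eigenvalues of θ.
  · refine Module.End.eigenvectors_linearIndependent' (heckeAction e θ) (fun φ ↦ φ θ) ?_ F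
      fun φ ↦ ⟨?_, hF0 φ⟩
    · intro φ ψ h
      have h2 : φ.toRatAlgHom = ψ.toRatAlgHom :=
        AlgHom.ext_of_adjoin_eq_top hθ (by rintro _ rfl; exact h)
      ext x
      exact DFunLike.congr_fun h2 x
    · exact Module.End.mem_eigenspace_iff.mpr (heckeAction_of_character e (hF0 φ) (hF φ) θ)
  · rw [eq_top_iff, ← iSup_eigenspace_heckeAction e θ]
    refine iSup_le fun μ f hf ↦ ?_
    rcases eq_or_ne f 0 with rfl | hf0
    · exact Submodule.zero_mem _
    obtain ⟨φ, hφ⟩ := exists_character_of_mem_eigenspace e hθ hf0 hf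
    rw [hmul f hf0 φ hφ]
    exact Submodule.smul_mem _ _ (Submodule.subset_span ⟨φ, rfl⟩)
  · intro f hf
    obtain ⟨φ, hφ⟩ := exists_character_of_isEigenform e hf
    exact ⟨φ, _, hmul f hf.1 φ hφ⟩

end HeckeField

/-! ### The Galois action on the embeddings -/

/-- The permutation of the embeddings of `K` into `ℂ` induced by an automorphism of `ℂ`. -/
def permEmbeddings (K : Type*) [Field K] : RingAut ℂ →* Equiv.Perm (K →+* ℂ) where
  toFun σ :=
    { toFun φ := (σ : ℂ →+* ℂ).comp φ
      invFun φ := (σ.symm : ℂ →+* ℂ).comp φ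
      left_inv φ := by ext x; exact σ.symm_apply_apply _
      right_inv φ := by ext x; exact σ.apply_symm_apply _ }
  map_one' := rfl
  map_mul' _ _ := rfl

theorem permEmbeddings_apply {K : Type*} [Field K] (σ : RingAut ℂ) (φ : K →+* ℂ) (x : K) :
    permEmbeddings K σ φ x = σ (φ x) := rfl

/-- The Galois group of the closure L acts faithfully on the embeddings, because their images
generate L. Its order n! is that of the full permutation group, so counting gives everything; the
particular isomorphism plays no further role. -/
theorem permEmbeddings_surjective {K : Type*} [Field K] [NumberField K] {n : ℕ}
    (hcard : Fintype.card (K →+* ℂ) = n)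
    (h : Nonempty (Gal(IntermediateField.normalClosure ℚ K ℂ/ℚ) ≃* Equiv.Perm (Fin n))) :
    Function.Surjective (permEmbeddings K) := by
  set L := IntermediateField.normalClosure ℚ K ℂ
  obtain ⟨eq⟩ := h
  have hext : ∀ τ : Gal(L/ℚ), ∃ σ : RingAut ℂ, ∀ x : L, σ (x : ℂ) = τ x := fun τ ↦
    exists_ringEquiv_comp_eq L.val (L.val.comp τ.toAlgHom)
  choose s hs using hext
  have hinj : Function.Injective fun τ ↦ permEmbeddings K (s τ) := by
    intro τ τ' h
    have hle : L ≤ (AlgHom.equalizer (s τ : ℂ →+* ℂ).toRatAlgHom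
        (s τ' : ℂ →+* ℂ).toRatAlgHom).toIntermediateField fun x hx ↦ by
          simp_all := by
      refine iSup_le fun φ ↦ ?_
      rintro _ ⟨x, rfl⟩
      exact DFunLike.congr_fun (DFunLike.congr_fun h φ.toRingHom) x
    ext x
    have h2 : s τ x = s τ' x := hle x.2
    rw [hs, hs] at h2
    exact h2
  have : Finite Gal(L/ℚ) := Finite.of_equiv _ eq.toEquiv.symm
  have hbij : Function.Bijective fun τ ↦ permEmbeddings K (s τ) := by
    rw [Nat.bijective_iff_injective_and_card]
    refine ⟨hinj, ?_⟩
    rw [Nat.card_congr eq.toEquiv, Nat.card_perm, Nat.card_perm, Nat.card_fin,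
      Nat.card_eq_fintype_card, hcard]
  intro p
  obtain ⟨τ, hτ⟩ := hbij.2 p
  exact ⟨s τ, hτ⟩

theorem exists_mem_ker_permEmbeddings {K₁ K₂ : Type*} [Field K₁] [NumberField K₁] [Field K₂]
    [NumberField K₂] (hsurj : Function.Surjective (permEmbeddings K₂))
    (hcard : Fintype.card (K₁ →+* ℂ) < Fintype.card (K₂ →+* ℂ)) (ψ ψ' : K₂ →+* ℂ) :
    ∃ σ ∈ (permEmbeddings K₁).ker, permEmbeddings K₂ σ ψ = ψ' := by
  have hnormal : ((permEmbeddings K₁).ker.map (permEmbeddings K₂)).Normal :=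
    Subgroup.Normal.map inferInstance _ hsurj
  have hne : (permEmbeddings K₁).ker.map (permEmbeddings K₂) ≠ ⊥ := by
    intro h
    rw [Subgroup.map_eq_bot_iff] at h
    -- If the image were trivial, one kernel would lie in the other, and comparing indices n₂! would
    -- divide n₁! with n₁ < n₂.
    have h1 := Subgroup.index_dvd_of_le h
    rw [Subgroup.index_ker, Subgroup.index_ker, MonoidHom.range_eq_top.mpr hsurj,
      Subgroup.card_top] at h1
    have h2 := h1.trans (Subgroup.card_subgroup_dvd_card _)
    rw [Nat.card_perm, Nat.card_perm, Nat.card_eq_fintype_card, Nat.card_eq_fintype_card] at h2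
    have h3 := Nat.le_of_dvd (Nat.factorial_pos _) h2
    exact absurd ((Nat.factorial_lt Fintype.card_pos).mpr hcard) h3.not_gt
  obtain ⟨_, ⟨σ, hσ, rfl⟩, h⟩ := exists_mem_apply_eq_of_normal hne ψ ψ'
  exact ⟨σ, hσ, h⟩

/-- Applying σ to the coefficients of a σ-fixed combination conjugates the weights and permutes the
basis; linear independence then equates coordinates. -/
theorem IsEigenBasis.apply_permEmbeddings {k : ℤ} {K : Type} [Field K] [NumberField K]
    {t : ℕ+ → K} {F : (K →+* ℂ) → CuspForm 𝒮ℒ k} (hF : IsEigenBasis t F) {σ : RingAut ℂ}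
    {w : (K →+* ℂ) → ℂ}
    (hσ : ∀ n, σ (fourierCoeff n (∑ ψ, w ψ • F ψ)) = fourierCoeff n (∑ ψ, w ψ • F ψ))
    (ψ : K →+* ℂ) : w (permEmbeddings K σ ψ) = σ (w ψ) := by
  have hsum : ∑ ψ, w (permEmbeddings K σ ψ) • F (permEmbeddings K σ ψ) =
      ∑ ψ, σ (w ψ) • F (permEmbeddings K σ ψ) := by
    rw [Equiv.sum_comp (permEmbeddings K σ) (fun ψ ↦ w ψ • F ψ)]
    refine cuspForm_ext_of_fourierCoeff fun n hn ↦ ?_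
    rw [← hσ, map_sum, map_sum, map_sum]
    refine Finset.sum_congr rfl fun ψ _ ↦ ?_
    lift n to ℕ+ using Nat.pos_of_ne_zero hn
    rw [LinearMap.map_smul, LinearMap.map_smul, hF.fourierCoeff_eq, hF.fourierCoeff_eq,
      smul_eq_mul, smul_eq_mul, map_mul, permEmbeddings_apply]
  rw [← sub_eq_zero, ← Finset.sum_sub_distrib] at hsum
  simp_rw [← sub_smul] at hsum
  have hli := hF.linearIndependent.comp _ (permEmbeddings K σ).injective
  exact sub_eq_zero.mp (Fintype.linearIndependent_iff.mp hli _ hsum ψ)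

theorem IsEigenBasis.card_eq {k : ℤ} {K : Type} [Field K] [NumberField K]
    {t : ℕ+ → K} {F : (K →+* ℂ) → CuspForm 𝒮ℒ k} (hF : IsEigenBasis t F) :
    Fintype.card (K →+* ℂ) = Module.finrank ℂ (CuspForm 𝒮ℒ k) :=
  (Module.finrank_eq_card_basis (Module.Basis.mk hF.linearIndependent hF.span_eq_top.ge)).symm

/-! ### Dimensions -/

theorem finrank_cuspForm (n : ℕ) (hn : Even n) :
    Module.finrank ℂ (CuspForm 𝒮ℒ (n + 12)) =
      if n ≡ 2 [MOD 12] then n / 12 else n / 12 + 1 := by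
  have h1 : Module.rank ℂ (CuspForm 𝒮ℒ (n + 12)) = Module.rank ℂ (ModularForm 𝒮ℒ n) := by
    rw [CuspForm.discriminantEquiv.rank_eq, add_sub_cancel_right]
  rw [ModularForm.dimension_level_one n hn] at h1
  apply Module.finrank_eq_of_rank_eq
  rw [h1]

theorem exists_weight_eq (k : ℤ) [Nontrivial (CuspForm 𝒮ℒ k)] :
    ∃ n : ℕ, Even n ∧ n ≠ 2 ∧ k = n + 12 := by
  have hpos : 0 < Module.finrank ℂ (CuspForm 𝒮ℒ k) := Module.finrank_pos
  have h12 : 12 ≤ k := by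
    by_contra! h
    rw [Module.finrank, CuspForm.rank_eq_zero_of_weight_lt_twelve h] at hpos
    simp at hpos
  obtain ⟨n, rfl⟩ : ∃ n : ℕ, k = n + 12 := ⟨(k - 12).toNat, by omega⟩
  have heven : Even n := by
    by_contra hodd
    rw [Nat.not_even_iff_odd] at hodd
    rw [CuspForm.discriminantEquiv.finrank_eq, add_sub_cancel_right, Module.finrank,
      ModularForm.levelOne_odd_weight_rank_zero (by exact_mod_cast hodd)] at hpos
    simp at hpos
  refine ⟨n, heven, ?_, rfl⟩
  rintro rfl
  rw [finrank_cuspForm 2 heven, if_pos (Nat.ModEq.refl 2)] at hpos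
  simp at hpos

/-- The exceptional class 2n + 12 ≡ 2 mod 12 would force n ≡ 1 mod 6, impossible for even n. -/
theorem finrank_cuspForm_two_mul (n : ℕ) (hn : Even n) :
    Module.finrank ℂ (CuspForm 𝒮ℒ (2 * (n + 12))) = n / 6 + 2 := by
  rw [show (2 * ((n : ℤ) + 12)) = ((2 * n + 12 : ℕ) : ℤ) + 12 by push_cast; ring,
    finrank_cuspForm _ (by grind), if_neg]
  · omega
  · intro h
    have := Nat.even_iff.mp hn
    simp only [Nat.ModEq] at h
    omega

theorem finrank_cuspForm_lt (k : ℤ) [Nontrivial (CuspForm 𝒮ℒ k)] :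
    Module.finrank ℂ (CuspForm 𝒮ℒ k) < Module.finrank ℂ (CuspForm 𝒮ℒ (2 * k)) := by
  obtain ⟨n, hn, -, rfl⟩ := exists_weight_eq k
  rw [finrank_cuspForm_two_mul n hn, finrank_cuspForm n hn]
  split_ifs <;> omega

/-! ### Squares of eigenforms -/

theorem eigenform_sq_uses_all_eigenforms
    (hMaeda : ∀ k : ℤ, Nontrivial (CuspForm 𝒮ℒ k) → MaedaConjecture k)
    {k : ℤ} {f : CuspForm 𝒮ℒ k} {d : ℕ} {g : Fin d → CuspForm 𝒮ℒ (2 * k)} {c : Fin d → ℂ}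
    (hf : IsEigenform f) (hg : ∀ i, IsEigenform (g i))
    (hne : ∀ i j, i ≠ j → ∀ t : ℂ, g i ≠ t • g j)
    (h : ∀ z : ℍ, f z ^ 2 = ∑ i, c i * g i z) :
    d = Module.finrank ℂ (CuspForm 𝒮ℒ (2 * k)) ∧
      ∀ h : CuspForm 𝒮ℒ (2 * k), IsEigenform h → ∃ i, ∃ t : ℂ, h = t • g i := by
  have hnt : Nontrivial (CuspForm 𝒮ℒ k) := ⟨f, 0, hf.1⟩
  have hlt := finrank_cuspForm_lt k
  have hnt2 : Nontrivial (CuspForm 𝒮ℒ (2 * k)) :=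
    Module.nontrivial_of_finrank_pos (Nat.zero_lt_of_lt hlt)
  obtain ⟨K₁, _, _, ⟨e₁⟩, -⟩ := hMaeda k hnt
  obtain ⟨K₂, _, _, ⟨e₂⟩, hGal⟩ := hMaeda (2 * k) hnt2
  obtain ⟨F₁, hF₁⟩ := exists_isEigenBasis e₁
  obtain ⟨F₂, hF₂⟩ := exists_isEigenBasis e₂
  have hsurj := permEmbeddings_surjective hF₂.card_eq hGal
  have htrans := exists_mem_ker_permEmbeddings (K₁ := K₁) hsurj
    (by rw [hF₁.card_eq, hF₂.card_eq]; exact hlt)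
  obtain ⟨φ, a, hfa⟩ := hF₁.exists_eq_smul f hf
  have ha : a ≠ 0 := by
    rintro rfl
    exact hf.1 (by rw [hfa, zero_smul])
  choose ψ b hgb using fun i ↦ hF₂.exists_eq_smul (g i) (hg i)
  have hb : ∀ i, b i ≠ 0 := fun i hi ↦ (hg i).1 (by rw [hgb, hi, zero_smul])
  have hψ : Function.Injective ψ := by
    intro i j hij
    by_contra hne'
    refine hne i j hne' (b i / b j) ?_
    rw [hgb i, hgb j, hij, smul_smul, div_mul_cancel₀ _ (hb j)]
  classical
  -- The coordinates of the square of the normalised form `F₁ φ` = f/a, hence the division by a².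
  let w : (K₂ →+* ℂ) → ℂ := fun χ ↦ ∑ i, if ψ i = χ then c i * b i / a ^ 2 else 0
  have hw0 : ∀ χ, w χ ≠ 0 → ∃ i, ψ i = χ := fun χ hχ ↦ by
    obtain ⟨i, -, hi⟩ := Finset.exists_ne_zero_of_sum_ne_zero hχ
    exact ⟨i, by_contra fun h ↦ hi (if_neg h)⟩
  have hsum : ∑ χ, w χ • F₂ χ = (a ^ 2)⁻¹ • ∑ i, c i • g i := by
    simp only [w, Finset.sum_smul, ite_smul, zero_smul]
    rw [Finset.sum_comm, Finset.smul_sum]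
    refine Finset.sum_congr rfl fun i _ ↦ ?_
    rw [Finset.sum_ite_eq, if_pos (Finset.mem_univ _), hgb, smul_smul, smul_smul]
    congr 1
    field_simp
  have hfun : ((∑ χ, w χ • F₂ χ : CuspForm 𝒮ℒ (2 * k)) : ℍ → ℂ) = F₁ φ * F₁ φ := by
    funext z
    have h1 : (∑ i, c i • g i : CuspForm 𝒮ℒ (2 * k)) z = ∑ i, c i * g i z := by
      simp
    have h2 : f z = a * F₁ φ z := by rw [hfa]; rfl
    rw [hsum]
    change (a ^ 2)⁻¹ * (∑ i, c i • g i : CuspForm 𝒮ℒ (2 * k)) z = F₁ φ z * F₁ φ z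
    rw [h1, ← h, h2]
    field_simp
  have hq : qExpansion 1 (∑ χ, w χ • F₂ χ : CuspForm 𝒮ℒ (2 * k)) =
      qExpansion 1 (F₁ φ) * qExpansion 1 (F₁ φ) := by
    rw [hfun, ModularForm.qExpansion_mul_coe one_pos one_mem_strictPeriods_SL]
  have hstable : ∀ σ ∈ (permEmbeddings K₁).ker, ∀ χ, w (permEmbeddings K₂ σ χ) = σ (w χ) := by
    intro σ hσ
    refine hF₂.apply_permEmbeddings ?_
    have hmap : (qExpansion 1 (F₁ φ)).map (σ : ℂ →+* ℂ) = qExpansion 1 (F₁ φ) := by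
      ext n
      rw [PowerSeries.coeff_map, ← fourierCoeff_apply]
      rcases Nat.eq_zero_or_pos n with rfl | hn
      · rw [fourierCoeff_zero, map_zero]
      · lift n to ℕ+ using hn
        rw [hF₁.fourierCoeff_eq φ]
        exact DFunLike.congr_fun (DFunLike.congr_fun (MonoidHom.mem_ker.mp hσ) φ) _
    intro n
    have h2 := congrArg (PowerSeries.coeff n) (congrArg (PowerSeries.map (σ : ℂ →+* ℂ)) hq)
    rw [map_mul, hmap, ← hq, PowerSeries.coeff_map] at h2
    exact h2
  obtain ⟨χ₀, hχ₀⟩ : ∃ χ, w χ ≠ 0 := by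
    by_contra! hall
    have h0 : (∑ χ, w χ • F₂ χ) = 0 := Finset.sum_eq_zero fun χ _ ↦ by rw [hall, zero_smul]
    rw [h0, FunLike.coe_zero, qExpansion_zero, eq_comm, mul_self_eq_zero] at hq
    have h1 := hF₁.fourierCoeff_one φ
    rw [fourierCoeff_apply, hq, map_zero] at h1
    exact zero_ne_one h1
  -- Transitivity carries the nonzero coordinate at χ₀ to any χ, and a nonzero coordinate can only
  -- come from some g i.
  have hψsurj : Function.Surjective ψ := fun χ ↦ by
    obtain ⟨σ, hσ, rfl⟩ := htrans χ₀ χ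
    refine hw0 _ ?_
    rw [hstable σ hσ]
    exact (map_ne_zero σ).mpr hχ₀
  refine ⟨?_, fun h hh ↦ ?_⟩
  · rw [← hF₂.card_eq, ← Fintype.card_fin d]
    exact Fintype.card_of_bijective ⟨hψ, hψsurj⟩
  · obtain ⟨χ, s, rfl⟩ := hF₂.exists_eq_smul h hh
    obtain ⟨i, rfl⟩ := hψsurj χ
    refine ⟨i, s / b i, ?_⟩
    rw [hgb, smul_smul, div_mul_cancel₀ _ (hb i)]

/-! ### Initial Fourier coefficients -/

/-- The first five coefficients of a power series. -/
def HasCoeffs (p : PowerSeries ℂ) (a₀ a₁ a₂ a₃ a₄ : ℂ) : Prop :=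
  p.coeff 0 = a₀ ∧ p.coeff 1 = a₁ ∧ p.coeff 2 = a₂ ∧ p.coeff 3 = a₃ ∧ p.coeff 4 = a₄

namespace HasCoeffs

variable {p q : PowerSeries ℂ} {a₀ a₁ a₂ a₃ a₄ b₀ b₁ b₂ b₃ b₄ : ℂ}

theorem mul (hp : HasCoeffs p a₀ a₁ a₂ a₃ a₄) (hq : HasCoeffs q b₀ b₁ b₂ b₃ b₄) :
    HasCoeffs (p * q) (a₀ * b₀) (a₀ * b₁ + a₁ * b₀) (a₀ * b₂ + a₁ * b₁ + a₂ * b₀)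
      (a₀ * b₃ + a₁ * b₂ + a₂ * b₁ + a₃ * b₀)
      (a₀ * b₄ + a₁ * b₃ + a₂ * b₂ + a₃ * b₁ + a₄ * b₀) := by
  obtain ⟨rfl, rfl, rfl, rfl, rfl⟩ := hp
  obtain ⟨rfl, rfl, rfl, rfl, rfl⟩ := hq
  refine ⟨?_, ?_, ?_, ?_, ?_⟩ <;>
    simp [PowerSeries.coeff_mul, Finset.Nat.antidiagonal_succ] <;> ring

theorem add (hp : HasCoeffs p a₀ a₁ a₂ a₃ a₄) (hq : HasCoeffs q b₀ b₁ b₂ b₃ b₄) :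
    HasCoeffs (p + q) (a₀ + b₀) (a₁ + b₁) (a₂ + b₂) (a₃ + b₃) (a₄ + b₄) := by
  obtain ⟨rfl, rfl, rfl, rfl, rfl⟩ := hp
  obtain ⟨rfl, rfl, rfl, rfl, rfl⟩ := hq
  exact ⟨rfl, rfl, rfl, rfl, rfl⟩

theorem smul (c : ℂ) (hp : HasCoeffs p a₀ a₁ a₂ a₃ a₄) :
    HasCoeffs (c • p) (c * a₀) (c * a₁) (c * a₂) (c * a₃) (c * a₄) := by
  obtain ⟨rfl, rfl, rfl, rfl, rfl⟩ := hp
  exact ⟨rfl, rfl, rfl, rfl, rfl⟩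

theorem congr (hp : HasCoeffs p a₀ a₁ a₂ a₃ a₄) (h₀ : a₀ = b₀) (h₁ : a₁ = b₁) (h₂ : a₂ = b₂)
    (h₃ : a₃ = b₃) (h₄ : a₄ = b₄) : HasCoeffs p b₀ b₁ b₂ b₃ b₄ := by
  subst h₀ h₁ h₂ h₃ h₄
  exact hp

end HasCoeffs

theorem hasCoeffs_E₄ : HasCoeffs (qExpansion 1 ModularForm.E₄) 1 240 2160 6720 17520 := by
  have hB : bernoulli 4 = -1 / 30 := by decide +kernel
  have h2 : ArithmeticFunction.sigma 3 2 = 9 := by decide +kernel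
  have h3 : ArithmeticFunction.sigma 3 3 = 28 := by decide +kernel
  have h4 : ArithmeticFunction.sigma 3 4 = 73 := by decide +kernel
  refine ⟨?_, ?_, ?_, ?_, ?_⟩ <;> rw [E_qExpansion_coeff _ ⟨2, rfl⟩] <;> norm_num [hB, h2, h3, h4]

theorem hasCoeffs_E₆ :
    HasCoeffs (qExpansion 1 ModularForm.E₆) 1 (-504) (-16632) (-122976) (-532728) := by
  have hB : bernoulli 6 = 1 / 42 := by decide +kernel
  have h2 : ArithmeticFunction.sigma 5 2 = 33 := by decide +kernel
  have h3 : ArithmeticFunction.sigma 5 3 = 244 := by decide +kernel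
  have h4 : ArithmeticFunction.sigma 5 4 = 1057 := by decide +kernel
  refine ⟨?_, ?_, ?_, ?_, ?_⟩ <;> rw [E_qExpansion_coeff _ ⟨3, rfl⟩] <;> norm_num [hB, h2, h3, h4]

theorem hasCoeffs_eisenstein12 : HasCoeffs (qExpansion 1 eisenstein12) 1 (65520 / 691)
    (65520 / 691 * 2049) (65520 / 691 * 177148) (65520 / 691 * 4196353) := by
  have hB : bernoulli 12 = -691 / 2730 := by decide +kernel
  have h2 : ArithmeticFunction.sigma 11 2 = 2049 := by decide +kernel
  have h3 : ArithmeticFunction.sigma 11 3 = 177148 := by decide +kernel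
  have h4 : ArithmeticFunction.sigma 11 4 = 4196353 := by decide +kernel
  have h := fun m ↦ E_qExpansion_coeff (k := 12) (by norm_num) ⟨6, rfl⟩ m
  refine ⟨(h 0).trans ?_, (h 1).trans ?_, (h 2).trans ?_, (h 3).trans ?_, (h 4).trans ?_⟩ <;>
    norm_num [hB, h2, h3, h4]

theorem hasCoeffs_discriminant :
    HasCoeffs (qExpansion 1 CuspForm.discriminant) 0 1 (-24) 252 (-1472) := by
  rw [qExpansion_discriminant, pow_succ, pow_two, pow_two, sub_eq_add_neg, ← neg_one_smul ℂ]
  refine ((((hasCoeffs_E₄.mul hasCoeffs_E₄).mul hasCoeffs_E₄).add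
    ((hasCoeffs_E₆.mul hasCoeffs_E₆).smul (-1))).smul (1 / 1728)).congr ?_ ?_ ?_ ?_ ?_ <;> norm_num

theorem qExpansion_form24 (r : ℂ) : qExpansion 1 (form24 r) =
    qExpansion 1 CuspForm.discriminant * qExpansion 1 eisenstein12 +
      (12 * r + 324204 / 691) •
        (qExpansion 1 CuspForm.discriminant * qExpansion 1 CuspForm.discriminant) := by
  rw [form24, FunLike.coe_add, ModularForm.qExpansion_add one_pos one_mem_strictPeriods_SL,
    FunLike.coe_smul, ModularForm.qExpansion_smul one_pos one_mem_strictPeriods_SL,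
    ← ModularForm.qExpansion_mul_coe one_pos one_mem_strictPeriods_SL,
    ← ModularForm.qExpansion_mul_coe one_pos one_mem_strictPeriods_SL]
  rfl

/-- The constant 324204/691 absorbs the 65520/691 of E₁₂: together they make 564, so the second
coefficient is 540 + 12r. -/
theorem hasCoeffs_form24 (r : ℂ) : HasCoeffs (qExpansion 1 (form24 r)) 0 1 (540 + 12 * r)
    (169740 - 576 * r) (12663328 + 12960 * r) := by
  rw [qExpansion_form24]
  refine ((hasCoeffs_discriminant.mul hasCoeffs_eisenstein12).add
    ((hasCoeffs_discriminant.mul hasCoeffs_discriminant).smul _)).congr ?_ ?_ ?_ ?_ ?_ <;> ring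

theorem qExpansion_form32 (r : ℂ) : qExpansion 1 (form32 r) =
    ((12 * r + 20532) / 1728) •
        (qExpansion 1 CuspForm.discriminant * qExpansion 1 ModularForm.E₄ ^ 5) +
      (1 - (12 * r + 20532) / 1728) • (qExpansion 1 CuspForm.discriminant *
        (qExpansion 1 ModularForm.E₄ ^ 2 * qExpansion 1 ModularForm.E₆ ^ 2)) := by
  rw [form32, FunLike.coe_add, ModularForm.qExpansion_add one_pos one_mem_strictPeriods_SL,
    FunLike.coe_smul, ModularForm.qExpansion_smul one_pos one_mem_strictPeriods_SL,
    FunLike.coe_smul, ModularForm.qExpansion_smul one_pos one_mem_strictPeriods_SL,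
    ← ModularForm.qExpansion_pow one_pos one_mem_strictPeriods_SL,
    ← ModularForm.qExpansion_pow one_pos one_mem_strictPeriods_SL,
    ← ModularForm.qExpansion_pow one_pos one_mem_strictPeriods_SL,
    ← ModularForm.qExpansion_mul one_pos one_mem_strictPeriods_SL,
    ← ModularForm.qExpansion_mul_coe one_pos one_mem_strictPeriods_SL,
    ← ModularForm.qExpansion_mul_coe one_pos one_mem_strictPeriods_SL]
  rfl

/-- ΔE₄⁵ and ΔE₄²E₆² have second coefficients 1176 and -552, differing by 1728; this explains the
denominator of x. -/
theorem hasCoeffs_form32 (r : ℂ) : HasCoeffs (qExpansion 1 (form32 r)) 0 1 (19980 + 12 * r)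
    (8681580 + 5184 * r) (886267168 + 479520 * r) := by
  rw [qExpansion_form32]
  have h2 := hasCoeffs_E₄.mul hasCoeffs_E₄
  have h5 := (h2.mul h2).mul hasCoeffs_E₄
  have h22 := h2.mul (hasCoeffs_E₆.mul hasCoeffs_E₆)
  simp only [← pow_two, ← pow_mul, ← pow_succ] at h5 h22
  refine (((hasCoeffs_discriminant.mul h5).smul _).add
    ((hasCoeffs_discriminant.mul h22).smul _)).congr ?_ ?_ ?_ ?_ ?_ <;> ring

/-! ### Eigenforms in weights with two-dimensional Sturm bound -/

theorem cuspForm_eq_zero_of_fourierCoeff {k : ℤ} (hk : k.toNat / 12 ≤ 2) {f : CuspForm 𝒮ℒ k}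
    (h1 : fourierCoeff 1 f = 0) (h2 : fourierCoeff 2 f = 0) : f = 0 := by
  refine (map_eq_zero_iff _ CuspForm.toModularFormₗ_injective).mp
    (ModularForm.sturm_bound_levelOne (lt_of_lt_of_le (b := ((3 : ℕ) : ℕ∞)) ?_
      (PowerSeries.nat_le_order _ _ fun i hi ↦ ?_)))
  · exact_mod_cast Nat.lt_succ_of_le hk
  · change fourierCoeff i f = 0
    interval_cases i
    · exact fourierCoeff_zero f
    · exact h1
    · exact h2

/-- By the Sturm bound a form is determined by its first two coefficients, so T₂f = a₂f reduces to
the stated relation. The other T_m follow by commuting with T₂. -/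
theorem isEigenform_of_eigenvector_two {k : ℤ} (hk : k.toNat / 12 ≤ 2)
    (hcomm : ∀ (m : ℕ+) (f : CuspForm 𝒮ℒ k), heckeT k 2 (heckeT k m f) = heckeT k m (heckeT k 2 f))
    {f : CuspForm 𝒮ℒ k} (h1 : fourierCoeff 1 f = 1)
    (h4 : fourierCoeff 4 f + 2 ^ (k - 1) = fourierCoeff 2 f ^ 2) : IsEigenform f := by
  have hT1 : ∀ f : CuspForm 𝒮ℒ k, fourierCoeff 1 (heckeT k 2 f) = fourierCoeff 2 f :=
    fourierCoeff_one_heckeT 2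
  have hT2 : heckeT k 2 f = fourierCoeff 2 f • f := by
    rw [← sub_eq_zero]
    apply cuspForm_eq_zero_of_fourierCoeff hk
    · rw [map_sub, map_smul, hT1, h1, smul_eq_mul, mul_one, sub_self]
    · rw [map_sub, map_smul, fourierCoeff_two_heckeT_two, h1, mul_one, h4, smul_eq_mul, pow_two,
        sub_self]
  refine ⟨?_, fun m ↦ ⟨fourierCoeff 1 (heckeT k m f), ?_⟩⟩
  · rintro rfl
    rw [map_zero] at h1
    exact zero_ne_one h1
  · rw [← sub_eq_zero]
    have hG : fourierCoeff 1 (heckeT k m f - fourierCoeff 1 (heckeT k m f) • f) = 0 := by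
      rw [map_sub, map_smul, h1, smul_eq_mul, mul_one, sub_self]
    refine cuspForm_eq_zero_of_fourierCoeff hk hG ?_
    -- For G = T_m f - λf, with λ chosen so that a₁(G) = 0, one has a₂(G) = a₁(T₂G) = a₂(f)·a₁(G) =
    -- 0.
    rw [← hT1]
    have : heckeT k 2 (heckeT k m f - fourierCoeff 1 (heckeT k m f) • f) =
        fourierCoeff 2 f • (heckeT k m f - fourierCoeff 1 (heckeT k m f) • f) := by
      rw [map_sub, map_smul, hcomm, hT2, map_smul, smul_sub, smul_comm]
    rw [this, map_smul, hG, smul_zero]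

theorem isEigenform_of_finrank_eq_one {k : ℤ} (hk : Module.finrank ℂ (CuspForm 𝒮ℒ k) = 1)
    {f : CuspForm 𝒮ℒ k} (hf : f ≠ 0) : IsEigenform f :=
  ⟨hf, fun m ↦ ((finrank_eq_one_iff_of_nonzero' f hf).mp hk (heckeT k m f)).imp fun _ h ↦ h.symm⟩

/-! ### The two identities of length two -/

theorem heckeT_comm_of_maedaConjecture {k : ℤ} (h : MaedaConjecture k) (m n : ℕ+)
    (f : CuspForm 𝒮ℒ k) : heckeT k m (heckeT k n f) = heckeT k n (heckeT k m f) := by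
  obtain ⟨K, _, _, ⟨e⟩, -⟩ := h
  exact heckeT_comm e m n f

theorem discriminant_ne_zero : CuspForm.discriminant ≠ 0 :=
  DFunLike.ne_iff.mpr ⟨I, ModularForm.discriminant_ne_zero _⟩

theorem isEigenform_discriminant : IsEigenform CuspForm.discriminant :=
  isEigenform_of_finrank_eq_one (finrank_cuspForm 0 (by decide)) discriminant_ne_zero

theorem form16_apply (z : ℍ) :
    form16 z = ModularForm.discriminant z * ModularForm.E₄ z := rfl

theorem form16_ne_zero : form16 ≠ 0 := by
  intro h
  obtain ⟨z, hz⟩ := DFunLike.ne_iff.mp (E_ne_zero (k := 4) (by norm_num) ⟨2, rfl⟩)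
  have h2 := DFunLike.congr_fun h z
  rw [form16_apply] at h2
  exact (mul_ne_zero (ModularForm.discriminant_ne_zero z) hz) h2

theorem finrank_cuspForm_sixteen : Module.finrank ℂ (CuspForm 𝒮ℒ 16) = 1 :=
  finrank_cuspForm 4 (by decide)

theorem isEigenform_form16 : IsEigenform form16 :=
  isEigenform_of_finrank_eq_one finrank_cuspForm_sixteen form16_ne_zero

theorem form24_ne_zero (r : ℂ) : form24 r ≠ 0 := by
  intro h
  have := (hasCoeffs_form24 r).2.1
  rw [← fourierCoeff_apply, h, map_zero] at this
  exact zero_ne_one this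

theorem form32_ne_zero (r : ℂ) : form32 r ≠ 0 := by
  intro h
  have := (hasCoeffs_form32 r).2.1
  rw [← fourierCoeff_apply, h, map_zero] at this
  exact zero_ne_one this

theorem isEigenform_form24 (h : MaedaConjecture 24) {r : ℂ} (hr : r ^ 2 = 144169) :
    IsEigenform (form24 r) := by
  obtain ⟨-, h1, h2, -, h4⟩ := hasCoeffs_form24 r
  refine isEigenform_of_eigenvector_two (by decide)
    (fun m f ↦ heckeT_comm_of_maedaConjecture h 2 m f) h1 ?_
  rw [fourierCoeff_apply, fourierCoeff_apply, h2, h4, show (24 - 1 : ℤ) = (23 : ℕ) by norm_num,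
    zpow_natCast]
  -- The terms linear in r cancel, leaving 144r² = 144·144169.
  linear_combination (-144) * hr

theorem isEigenform_form32 (h : MaedaConjecture 32) {r : ℂ} (hr : r ^ 2 = 18295489) :
    IsEigenform (form32 r) := by
  obtain ⟨-, h1, h2, -, h4⟩ := hasCoeffs_form32 r
  refine isEigenform_of_eigenvector_two (by decide)
    (fun m f ↦ heckeT_comm_of_maedaConjecture h 2 m f) h1 ?_
  rw [fourierCoeff_apply, fourierCoeff_apply, h2, h4, show (32 - 1 : ℤ) = (31 : ℕ) by norm_num,
    zpow_natCast]
  linear_combination (-144) * hr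

theorem form24_apply (r : ℂ) (z : ℍ) : form24 r z =
    CuspForm.discriminant z * eisenstein12 z +
      (12 * r + 324204 / 691) * (CuspForm.discriminant z * CuspForm.discriminant z) := rfl

theorem form32_apply (r : ℂ) (z : ℍ) : form32 r z =
    (12 * r + 20532) / 1728 * (ModularForm.discriminant z * ModularForm.E₄ z ^ 5) +
      (1 - (12 * r + 20532) / 1728) *
        (ModularForm.discriminant z * (ModularForm.E₄ z ^ 2 * ModularForm.E₆ z ^ 2)) := by
  have h4 : ∀ n, (ModularForm.E₄.pow n) z = ModularForm.E₄ z ^ n := fun n ↦ by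
    rw [ModularForm.coe_pow, Pi.pow_apply]
  have h6 : ∀ n, (ModularForm.E₆.pow n) z = ModularForm.E₆ z ^ n := fun n ↦ by
    rw [ModularForm.coe_pow, Pi.pow_apply]
  rw [← h4, ← h4, ← h6]
  rfl

theorem discriminant_sq {r : ℂ} (hr : r ≠ 0) (z : ℍ) : CuspForm.discriminant z ^ 2 =
    1 / (24 * r) * form24 r z + -(1 / (24 * r)) * form24 (-r) z := by
  rw [form24_apply, form24_apply]
  field_simp
  ring

/-- H(r) - H(-r) = (24r/1728)·ΔE₄²(E₄³ - E₆²) = 24r·(E₄Δ)². -/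
theorem form16_sq {r : ℂ} (hr : r ≠ 0) (z : ℍ) : form16 z ^ 2 =
    1 / (24 * r) * form32 r z + -(1 / (24 * r)) * form32 (-r) z := by
  rw [form32_apply, form32_apply, form16_apply,
    ModularForm.discriminant_eq_E₄_cube_sub_E₆_sq]
  field_simp
  ring

/-- An identity `f² = a₁ g₁ + a₂ g₂` between eigenforms forces the space of cusp forms of weight
`2k` to be two-dimensional; `g₁` and `g₂` are then not proportional, and they are the only
eigenforms up to scaling. -/
theorem eigenform_sq_eq_two
    (hMaeda : ∀ k : ℤ, Nontrivial (CuspForm 𝒮ℒ k) → MaedaConjecture k)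
    {k : ℤ} {f : CuspForm 𝒮ℒ k} {g₁ g₂ : CuspForm 𝒮ℒ (2 * k)} {a₁ a₂ : ℂ}
    (hf : IsEigenform f) (hg₁ : IsEigenform g₁) (hg₂ : IsEigenform g₂)
    (h : ∀ z : ℍ, f z ^ 2 = a₁ * g₁ z + a₂ * g₂ z) :
    Module.finrank ℂ (CuspForm 𝒮ℒ (2 * k)) = 2 ∧ (∀ t : ℂ, g₁ ≠ t • g₂) ∧
      (∀ t : ℂ, g₂ ≠ t • g₁) ∧
      ∀ h : CuspForm 𝒮ℒ (2 * k), IsEigenform h → (∃ t : ℂ, h = t • g₁) ∨ ∃ t : ℂ, h = t • g₂ := by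
  have hnt : Nontrivial (CuspForm 𝒮ℒ k) := ⟨f, 0, hf.1⟩
  -- A one-term identity would force dim S_{2k} = 1, whereas that dimension is at least 2.
  -- Proportional g₁ and g₂ would merge into such an identity.
  have hsub : ¬ ∃ (d : ℂ) (g : CuspForm 𝒮ℒ (2 * k)), IsEigenform g ∧ ∀ z, f z ^ 2 = d * g z := by
    rintro ⟨d, g, hg, h⟩
    have h1 := (eigenform_sq_uses_all_eigenforms hMaeda (d := 1) (g := fun _ ↦ g)
      (c := fun _ ↦ d) hf (fun _ ↦ hg) (fun i j hij ↦ absurd (Subsingleton.elim i j) hij)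
      (fun z ↦ by simpa using h z)).1
    obtain ⟨n, hn, -, rfl⟩ := exists_weight_eq k
    rw [finrank_cuspForm_two_mul n hn] at h1
    omega
  have h12 : ∀ t : ℂ, g₁ ≠ t • g₂ := by
    rintro t rfl
    refine hsub ⟨a₁ * t + a₂, g₂, hg₂, fun z ↦ ?_⟩
    rw [h z]
    change a₁ * (t * g₂ z) + a₂ * g₂ z = _
    ring
  have h21 : ∀ t : ℂ, g₂ ≠ t • g₁ := by
    rintro t rfl
    refine hsub ⟨a₁ + a₂ * t, g₁, hg₁, fun z ↦ ?_⟩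
    rw [h z]
    change a₁ * g₁ z + a₂ * (t * g₁ z) = _
    ring
  obtain ⟨h1, h2⟩ := eigenform_sq_uses_all_eigenforms hMaeda (d := 2) (g := ![g₁, g₂])
    (c := ![a₁, a₂]) hf (by simp [Fin.forall_fin_two, hg₁, hg₂])
    (by simpa [Fin.forall_fin_two] using ⟨h12, h21⟩) (fun z ↦ by simpa using h z)
  refine ⟨h1.symm, h12, h21, fun g hg ↦ ?_⟩
  simpa [Fin.exists_fin_two] using h2 g hg

/-- Uniqueness of an identity `f² = a₁ g₁ + a₂ g₂`, given one such identity. -/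
theorem eigenform_sq_eq_two_unique
    (hMaeda : ∀ k : ℤ, Nontrivial (CuspForm 𝒮ℒ k) → MaedaConjecture k)
    {k l : ℤ} (hl : l = 2 * k) {f f₀ : CuspForm 𝒮ℒ k} {g₁ g₂ : CuspForm 𝒮ℒ (2 * k)}
    {G₁ G₂ : CuspForm 𝒮ℒ l} {a₁ a₂ b₁ b₂ c : ℂ}
    (hf : IsEigenform f) (hg₁ : IsEigenform g₁) (hg₂ : IsEigenform g₂)
    (h : ∀ z : ℍ, f z ^ 2 = a₁ * g₁ z + a₂ * g₂ z)
    (hf₀ : IsEigenform f₀) (hG₁ : IsEigenform G₁) (hG₂ : IsEigenform G₂)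
    (h₀ : ∀ z : ℍ, f₀ z ^ 2 = b₁ * G₁ z + b₂ * G₂ z) (hff₀ : f = c • f₀) :
    (∃ s t : ℂ, (∀ z, g₁ z = s * G₁ z) ∧ (∀ z, g₂ z = t * G₂ z) ∧
        a₁ * s = c ^ 2 * b₁ ∧ a₂ * t = c ^ 2 * b₂) ∨
      (∃ s t : ℂ, (∀ z, g₁ z = s * G₂ z) ∧ (∀ z, g₂ z = t * G₁ z) ∧
        a₁ * s = c ^ 2 * b₂ ∧ a₂ * t = c ^ 2 * b₁) := by
  subst hl
  obtain ⟨-, h12, h21, -⟩ := eigenform_sq_eq_two hMaeda hf hg₁ hg₂ h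
  obtain ⟨-, H12, H21, H⟩ := eigenform_sq_eq_two hMaeda hf₀ hG₁ hG₂ h₀
  have hli : ∀ x y : ℂ, (∀ z, x * G₁ z + y * G₂ z = 0) → x = 0 ∧ y = 0 := by
    intro x y hxy
    by_cases hx : x = 0
    · subst hx
      have hxy' : y • G₂ = 0 := DFunLike.ext _ _ fun z ↦ by
        change y * G₂ z = 0
        simpa only [zero_mul, zero_add] using hxy z
      exact ⟨rfl, (smul_eq_zero.mp hxy').resolve_right hG₂.1⟩
    · refine absurd ?_ (H12 (-(x⁻¹ * y)))
      refine DFunLike.ext _ _ fun z ↦ ?_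
      change G₁ z = -(x⁻¹ * y) * G₂ z
      field_simp
      linear_combination hxy z
  have hprop : ∀ {g g' G : CuspForm 𝒮ℒ (2 * k)}, IsEigenform g' → (∀ t : ℂ, g ≠ t • g') →
      (∃ s : ℂ, g = s • G) → (∃ s : ℂ, g' = s • G) → False := by
    rintro g g' G hg' hne ⟨s, rfl⟩ ⟨s', rfl⟩
    have hs' : s' ≠ 0 := fun h ↦ hg'.1 (by rw [h, zero_smul])
    exact hne (s / s') (by rw [smul_smul, div_mul_cancel₀ _ hs'])
  have hsq : ∀ z, a₁ * g₁ z + a₂ * g₂ z = c ^ 2 * (b₁ * G₁ z + b₂ * G₂ z) := fun z ↦ by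
    rw [← h, ← h₀, hff₀]
    change (c * f₀ z) ^ 2 = _
    ring
  -- Each gᵢ lies on one of the lines of G₁, G₂. The same line is excluded, and in the two remaining
  -- cases coefficients are compared.
  rcases H g₁ hg₁ with ⟨s, hs⟩ | ⟨s, hs⟩ <;> rcases H g₂ hg₂ with ⟨t, ht⟩ | ⟨t, ht⟩
  · exact (hprop hg₂ h12 ⟨s, hs⟩ ⟨t, ht⟩).elim
  · left
    refine ⟨s, t, DFunLike.congr_fun hs, DFunLike.congr_fun ht, ?_⟩
    obtain ⟨h1, h2⟩ := hli (a₁ * s - c ^ 2 * b₁) (a₂ * t - c ^ 2 * b₂) fun z ↦ by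
      have := hsq z
      rw [hs, ht] at this
      change a₁ * (s * G₁ z) + a₂ * (t * G₂ z) = _ at this
      linear_combination this
    exact ⟨sub_eq_zero.mp h1, sub_eq_zero.mp h2⟩
  · right
    refine ⟨s, t, DFunLike.congr_fun hs, DFunLike.congr_fun ht, ?_⟩
    obtain ⟨h1, h2⟩ := hli (a₂ * t - c ^ 2 * b₁) (a₁ * s - c ^ 2 * b₂) fun z ↦ by
      have := hsq z
      rw [hs, ht] at this
      change a₁ * (s * G₂ z) + a₂ * (t * G₁ z) = _ at this
      linear_combination this
    exact ⟨sub_eq_zero.mp h2, sub_eq_zero.mp h1⟩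
  · exact (hprop hg₂ h12 ⟨s, hs⟩ ⟨t, ht⟩).elim

end HeckeSquare

end

/-! ### The main theorem -/

theorem mainTheorem5
    (hMaeda : ∀ k : ℤ, Nontrivial (CuspForm 𝒮ℒ k) → HeckeSquare.MaedaConjecture k) :
    -- every identity `f² = ∑ cᵢ gᵢ` uses a full set of eigenforms of weight `2k`
    (∀ (k : ℤ) (f : CuspForm 𝒮ℒ k) (d : ℕ) (g : Fin d → CuspForm 𝒮ℒ (2 * k)) (c : Fin d → ℂ),
      HeckeSquare.IsEigenform f →
      (∀ i, HeckeSquare.IsEigenform (g i)) →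
      (∀ i j, i ≠ j → ∀ t : ℂ, g i ≠ t • g j) →
      (∀ i, c i ≠ 0) →
      (∀ z : UpperHalfPlane, f z ^ 2 = ∑ i, c i * g i z) →
        d = Module.finrank ℂ (CuspForm 𝒮ℒ (2 * k)) ∧
        ∀ h : CuspForm 𝒮ℒ (2 * k), HeckeSquare.IsEigenform h → ∃ i, ∃ t : ℂ, h = t • g i) ∧
    -- the two identities of length two, in weights 12 and 16, do hold
    (∀ r : ℂ, r ^ 2 = 144169 →
      HeckeSquare.IsEigenform CuspForm.discriminant ∧
      HeckeSquare.IsEigenform (HeckeSquare.form24 r) ∧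
      ∀ z : UpperHalfPlane, CuspForm.discriminant z ^ 2 =
        1 / (24 * r) * HeckeSquare.form24 r z + -(1 / (24 * r)) * HeckeSquare.form24 (-r) z) ∧
    (∀ r : ℂ, r ^ 2 = 18295489 →
      HeckeSquare.IsEigenform HeckeSquare.form16 ∧
      HeckeSquare.IsEigenform (HeckeSquare.form32 r) ∧
      ∀ z : UpperHalfPlane, HeckeSquare.form16 z ^ 2 =
        1 / (24 * r) * HeckeSquare.form32 r z + -(1 / (24 * r)) * HeckeSquare.form32 (-r) z) ∧
    -- and up to rescaling and order they are the only ones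
    (∀ (k : ℤ) (f : CuspForm 𝒮ℒ k) (g₁ g₂ : CuspForm 𝒮ℒ (2 * k)) (a₁ a₂ : ℂ),
      HeckeSquare.IsEigenform f → HeckeSquare.IsEigenform g₁ → HeckeSquare.IsEigenform g₂ →
      (∀ z : UpperHalfPlane, f z ^ 2 = a₁ * g₁ z + a₂ * g₂ z) →
        (k = 12 ∧ ∃ r c s t : ℂ, r ^ 2 = 144169 ∧
          (∀ z, f z = c * CuspForm.discriminant z) ∧
          (∀ z, g₁ z = s * HeckeSquare.form24 r z) ∧
          (∀ z, g₂ z = t * HeckeSquare.form24 (-r) z) ∧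
          a₁ * s = c ^ 2 * (1 / (24 * r)) ∧ a₂ * t = c ^ 2 * -(1 / (24 * r))) ∨
        (k = 16 ∧ ∃ r c s t : ℂ, r ^ 2 = 18295489 ∧
          (∀ z, f z = c * HeckeSquare.form16 z) ∧
          (∀ z, g₁ z = s * HeckeSquare.form32 r z) ∧
          (∀ z, g₂ z = t * HeckeSquare.form32 (-r) z) ∧
          a₁ * s = c ^ 2 * (1 / (24 * r)) ∧ a₂ * t = c ^ 2 * -(1 / (24 * r)))) := by
  have hMaeda24 : HeckeSquare.MaedaConjecture 24 :=
    hMaeda 24 ⟨HeckeSquare.form24 0, 0, HeckeSquare.form24_ne_zero 0⟩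
  have hMaeda32 : HeckeSquare.MaedaConjecture 32 :=
    hMaeda 32 ⟨HeckeSquare.form32 0, 0, HeckeSquare.form32_ne_zero 0⟩
  have hr24 : ∀ {r : ℂ}, r ^ 2 = 144169 → r ≠ 0 := by
    rintro r hr rfl
    norm_num at hr
  have hr32 : ∀ {r : ℂ}, r ^ 2 = 18295489 → r ≠ 0 := by
    rintro r hr rfl
    norm_num at hr
  refine ⟨fun k f d g c hf hg hne _ h ↦
      HeckeSquare.eigenform_sq_uses_all_eigenforms hMaeda hf hg hne h,
    fun r hr ↦ ⟨HeckeSquare.isEigenform_discriminant, HeckeSquare.isEigenform_form24 hMaeda24 hr,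
      HeckeSquare.discriminant_sq (hr24 hr)⟩,
    fun r hr ↦ ⟨HeckeSquare.isEigenform_form16, HeckeSquare.isEigenform_form32 hMaeda32 hr,
      HeckeSquare.form16_sq (hr32 hr)⟩, ?_⟩
  intro k f g₁ g₂ a₁ a₂ hf hg₁ hg₂ h
  have hnt : Nontrivial (CuspForm 𝒮ℒ k) := ⟨f, 0, hf.1⟩
  have hdim := (HeckeSquare.eigenform_sq_eq_two hMaeda hf hg₁ hg₂ h).1
  -- For k = n + 12, dimension n/6 + 2 = 2 gives n < 6; n is even and not 2 (as S₁₄ = 0), so n = 0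
  -- or 4.
  have hk : k = 12 ∨ k = 16 := by
    obtain ⟨n, hn, hn2, rfl⟩ := HeckeSquare.exists_weight_eq k
    rw [HeckeSquare.finrank_cuspForm_two_mul n hn] at hdim
    have := Nat.even_iff.mp hn
    omega
  rcases hk with rfl | rfl
  · left
    refine ⟨rfl, ?_⟩
    obtain ⟨c, rfl⟩ := CuspForm.exists_smul_discriminant_of_weight_eq_twelve f
    obtain ⟨r, hr⟩ := IsAlgClosed.exists_pow_nat_eq (144169 : ℂ) two_pos
    have hr' : (-r) ^ 2 = 144169 := by rw [neg_sq, hr]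
    rcases HeckeSquare.eigenform_sq_eq_two_unique hMaeda (l := 24) (by norm_num) hf hg₁ hg₂ h
      HeckeSquare.isEigenform_discriminant
      (HeckeSquare.isEigenform_form24 hMaeda24 hr) (HeckeSquare.isEigenform_form24 hMaeda24 hr')
      (HeckeSquare.discriminant_sq (hr24 hr)) rfl
      with ⟨s, t, hs, ht, h1, h2⟩ | ⟨s, t, hs, ht, h1, h2⟩
    · exact ⟨r, c, s, t, hr, fun _ ↦ rfl, hs, ht, h1, h2⟩
    -- The exchanged order of the two forms is absorbed by taking the other square root -r.
    · refine ⟨-r, c, s, t, hr', fun _ ↦ rfl, hs, by simpa only [neg_neg] using ht, ?_, ?_⟩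
      · rw [h1]; ring
      · rw [h2]; ring
  · right
    refine ⟨rfl, ?_⟩
    obtain ⟨c, rfl⟩ := (finrank_eq_one_iff_of_nonzero' _ HeckeSquare.form16_ne_zero).mp
      HeckeSquare.finrank_cuspForm_sixteen f
    obtain ⟨r, hr⟩ := IsAlgClosed.exists_pow_nat_eq (18295489 : ℂ) two_pos
    have hr' : (-r) ^ 2 = 18295489 := by rw [neg_sq, hr]
    rcases HeckeSquare.eigenform_sq_eq_two_unique hMaeda (l := 32) (by norm_num) hf hg₁ hg₂ h
      HeckeSquare.isEigenform_form16
      (HeckeSquare.isEigenform_form32 hMaeda32 hr) (HeckeSquare.isEigenform_form32 hMaeda32 hr')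
      (HeckeSquare.form16_sq (hr32 hr)) rfl
      with ⟨s, t, hs, ht, h1, h2⟩ | ⟨s, t, hs, ht, h1, h2⟩
    · exact ⟨r, c, s, t, hr, fun _ ↦ rfl, hs, ht, h1, h2⟩
    · refine ⟨-r, c, s, t, hr', fun _ ↦ rfl, hs, by simpa only [neg_neg] using ht, ?_, ?_⟩
      · rw [h1]; ring
      · rw [h2]; ring
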